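/- Let $1\le k\le n$, write $\mathbb{R}^n_+=\{y\in\mathbb{R}^n: y_j\ge 0 \text{ for all } j\}$, let $a_1,\dots,a_n\in\mathbb{R}^k$, and let $A=(a_1,\dots,a_n)$ be the $k\times n$ matrix with columns $a_j$. Let $C$ be a real symmetric $k\times k$ matrix with $\langle Ca_j,a_j\rangle>0$ for all $j$, and let $B:\mathbb{R}^n_+\to\mathbb{R}$ satisfy: L1. $B\in C(\mathbb{R}^n_+)\cap C^2(\mathrm{int}\,\mathbb{R}^n_+)$. L2. $B(\lambda y)=\lambda^kB(y)$ for all $\lambda\ge 0$ and $y\in\mathbb{R}^n_+$. L3. $(A^*CA)\bullet \mathrm{Hess}\,B(y)\le 0$ (negative semidefinite) for all $y\in\mathrm{int}\,\mathbb{R}^n_+$, where $\bullet$ is the Hadamard (entrywise) product. L4. $B\ge 0$ and $B$ is not identically $0$. L5. $\int_{\mathbb{R}^k}B\big(e^{-\langle a_1,x\rangle^2},\dots,e^{-\langle a_n,x\rangle^2}\big)\,dx<\infty$. Let $u_1,\dots,u_n:\mathbb{R}\to[0,\infty)$ be Lebesgue measurable functions such that $\int_{\mathbb{R}}u_j>0$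 and, for some constants $b_j,\delta_j>0$, $u_j(y)\le b_je^{-\delta_jy^2}$ for all $y\in\mathbb{R}$. For $t>0$ let $$u_j(y,t)=\frac{1}{\sqrt{4\pi t\langle Ca_j,a_j\rangle}}\int_{\mathbb{R}}u_j(s)\,e^{-\frac{(y-s)^2}{4t\langle Ca_j,a_j\rangle}}\,ds$$ be the heat extension of $u_j$ (the solution of $\partial_tu_j=\langle Ca_j,a_j\rangle\,\partial_y^2u_j$ with initial value $u_j$), and for $x\in\mathbb{R}^k$ put $$\mathbf{u}(x,t)=\big(u_j(\langle a_j,x\rangle,t)\big)_{j=1}^n,\qquad \mathbf{u}'(x,t)=\big(\partial_yu_j(y,t)|_{y=\langle a_j,x\rangle}\big)_{j=1}^n .$$ Then $$\int_{\mathbb{R}^k}B\big(u_1(\langle a_1,x\rangle),\dots,u_n(\langle a_n,x\rangle)\big)\,dx\le\int_{\mathbb{R}^k}B\left(\frac{e^{-\frac{\langle a_1,x\rangle^2}{\langle Ca_1,a_1\rangle}}}{\sqrt{\pi\langle Ca_1,a_1\rangle}}\int_{\mathbb{R}}u_1,\ \dots,\ \frac{e^{-\frac{\langle a_n,x\rangle^2}{\langle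 Ca_n,a_n\rangle}}}{\sqrt{\pi\langle Ca_n,a_n\rangle}}\int_{\mathbb{R}}u_n\right)dx,$$ where both integrals are finite. Equality holds if and only if $$\big[(A^*CA)\bullet\mathrm{Hess}\,B(\mathbf{u}(x,t))\big]\,\mathbf{u}'(x,t)=0\quad\text{for all }x\in\mathbb{R}^k\text{ and all }t>0 .$$ -/

import Mathlib

open MeasureTheory
open scoped Matrix

/-- The closed orthant `ℝⁿ₊ = {y : y_j ≥ 0 for all j}`. -/
def closedOrthant (n : ℕ) : Set (Fin n → ℝ) := {y | ∀ j, 0 ≤ y j}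

/-- The open orthant `{y : y_j > 0 for all j}`, the interior of `ℝⁿ₊`. -/
def openOrthant (n : ℕ) : Set (Fin n → ℝ) := {y | ∀ j, 0 < y j}

theorem interior_closedOrthant (n : ℕ) : interior (closedOrthant n) = openOrthant n := by
  have h1 : closedOrthant n = Set.pi Set.univ (fun _ => Set.Ici (0 : ℝ)) := by
    ext y; simp only [closedOrthant, Set.mem_ofPred_eq, Set.mem_univ_pi, Set.mem_Ici]
  have h2 : openOrthant n = Set.pi Set.univ (fun _ => Set.Ioi (0 : ℝ)) := by
    ext y; simp [openOrthant]
  rw [h1, h2, interior_pi_set Set.finite_univ]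
  simp

/-- The Hessian matrix `(∂²B/∂y_i∂y_j)(y)`. -/
noncomputable def hessian {n : ℕ} (B : (Fin n → ℝ) → ℝ) (y : Fin n → ℝ) :
    Matrix (Fin n) (Fin n) ℝ :=
  Matrix.of fun i j => fderiv ℝ (fderiv ℝ B) y (Pi.single i 1) (Pi.single j 1)

/-- The `k × n` matrix `A = (a_1, …, a_n)` whose columns are the vectors `a_j`. -/
def colMatrix {k n : ℕ} (a : Fin n → EuclideanSpace ℝ (Fin k)) : Matrix (Fin k) (Fin n) ℝ :=
  Matrix.of fun i j => a j i

/-- The number `⟨C v, v⟩`. -/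
noncomputable def quadForm {k : ℕ} (C : Matrix (Fin k) (Fin k) ℝ)
    (v : EuclideanSpace ℝ (Fin k)) : ℝ :=
  ∑ i, (∑ l, C i l * v l) * v i

/-- The matrix `(A* C A) • Hess B(y)`, where `•` is the Hadamard (entrywise) product. -/
noncomputable def concavityMatrix {k n : ℕ} (a : Fin n → EuclideanSpace ℝ (Fin k))
    (C : Matrix (Fin k) (Fin k) ℝ) (B : (Fin n → ℝ) → ℝ) (y : Fin n → ℝ) :
    Matrix (Fin n) (Fin n) ℝ :=
  ((colMatrix a)ᵀ * C * colMatrix a) ⊙ hessian B y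

/-- Bellman functions of Brascamp–Lieb type for the vectors `a_1, …, a_n` of `ℝᵏ`, with respect
to the matrix `C`. Only the values of `B` on the closed orthant matter. -/
structure IsBrascampLiebBellman {k n : ℕ} (a : Fin n → EuclideanSpace ℝ (Fin k))
    (C : Matrix (Fin k) (Fin k) ℝ) (B : (Fin n → ℝ) → ℝ) : Prop where
  continuousOn : ContinuousOn B (closedOrthant n)
  contDiffOn : ContDiffOn ℝ 2 B (openOrthant n)
  homogeneous : ∀ r : ℝ, 0 ≤ r → ∀ y ∈ closedOrthant n, B (r • y) = r ^ k * B y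
  symm : C.IsSymm
  concave : ∀ y ∈ openOrthant n, (-concavityMatrix a C B y).PosSemidef
  quadForm_pos : ∀ j, 0 < quadForm C (a j)
  nonneg : ∀ y ∈ closedOrthant n, 0 ≤ B y
  not_zero : ∃ y ∈ closedOrthant n, B y ≠ 0
  integrable_exp : Integrable (fun x : EuclideanSpace ℝ (Fin k) =>
    B fun j => Real.exp (-(inner ℝ (a j) x) ^ 2))

/-- The class `E(ℝ)`: (Lebesgue measurable) functions with Gaussian decay. -/
def GaussianDecay (u : ℝ → ℝ) : Prop :=
  AEMeasurable u ∧ ∃ b > 0, ∃ δ > 0, ∀ y, |u y| ≤ b * Real.exp (-δ * y ^ 2)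

/-- The heat extension `u(y, t)`, for `t > 0`: the solution of `∂u/∂t = σ ∂²u/∂y²` with initial
value `u`, given by convolution with the heat kernel. -/
noncomputable def heatExtension (σ : ℝ) (u : ℝ → ℝ) (y t : ℝ) : ℝ :=
  1 / Real.sqrt (4 * Real.pi * t * σ) *
    ∫ x, u x * Real.exp (-(y - x) ^ 2 / (4 * t * σ))

/-- The vector `𝐮(x, t)` with entries `u_j(⟨a_j, x⟩, t)`, where `u_j(y, t)` is the heat extension
of `u_j` with `σ = ⟨C a_j, a_j⟩`. -/
noncomputable def heatVec {k n : ℕ} (a : Fin n → EuclideanSpace ℝ (Fin k))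
    (C : Matrix (Fin k) (Fin k) ℝ) (u : Fin n → ℝ → ℝ)
    (x : EuclideanSpace ℝ (Fin k)) (t : ℝ) : Fin n → ℝ :=
  fun j => heatExtension (quadForm C (a j)) (u j) (inner ℝ (a j) x) t

/-- The vector `𝐮'(x, t)` whose entries are `∂u_j(y, t)/∂y` at `y = ⟨a_j, x⟩`. -/
noncomputable def heatVecDeriv {k n : ℕ} (a : Fin n → EuclideanSpace ℝ (Fin k))
    (C : Matrix (Fin k) (Fin k) ℝ) (u : Fin n → ℝ → ℝ)
    (x : EuclideanSpace ℝ (Fin k)) (t : ℝ) : Fin n → ℝ :=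
  fun j => deriv (fun y => heatExtension (quadForm C (a j)) (u j) y t) (inner ℝ (a j) x)

/-- `B(u_1(⟨a_1, x⟩), …, u_n(⟨a_n, x⟩))`. -/
noncomputable def bellmanIntegrand {k n : ℕ} (a : Fin n → EuclideanSpace ℝ (Fin k))
    (B : (Fin n → ℝ) → ℝ) (u : Fin n → ℝ → ℝ) (x : EuclideanSpace ℝ (Fin k)) : ℝ :=
  B fun j => u j (inner ℝ (a j) x)

/-- The centred Gaussian `y ↦ e^{-y²/σ} / √(πσ) · ∫ u`, which has the same integral as `u`. -/
noncomputable def gaussianOfMass (σ : ℝ) (u : ℝ → ℝ) (y : ℝ) : ℝ :=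
  Real.exp (-y ^ 2 / σ) / Real.sqrt (Real.pi * σ) * ∫ s, u s

/-! The proof is a heat-flow monotonicity argument. Put σ_j = ⟨C a_j, a_j⟩, `f(t, x) = B(𝐮(x, t))`
and `F(t) = ∫ f(t, x) dx`. By the chain rule, `∑ C_{pq} ∂_p ∂_q f` is the quadratic form of `(A*CA)
• Hess B` at `𝐮'` plus `∑ ∂_j B · σ_j u_j''`. The last sum is `∂_t f`, because `u_j` diffuses at
rate σ_j. Hence `∂_t f = ∑ C_{pq} ∂_p ∂_q f + Q`, where `Q ≥ 0` by L3 (`solvesForcedHeat`).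

The second-order operator has constant coefficients, so it contributes nothing to `∫ f`. This is
proved with cutoffs that carry both derivatives, so neither ellipticity of `C` nor decay of `∇f` is
needed (`tendsto_integral_cutoff_mul_source`). So `F` is nondecreasing, and it is constant exactly
when `Q` vanishes.

The two sides of the inequality are the limits of `F` at `0` and at infinity. At `0` the heat
extensions return to `u_j` almost everywhere. At infinity the dilation `x ↦ 2√t x` leaves `F`
unchanged, since the degree of homogeneity `k` is the dimension, while the rescaled `u_j` converge
to Gaussians of the same mass.

Both limits and the cutoff argument need an integrable majorant. The diagonal of L3 makes `B`
concave in each variable; being nonnegative it is then nondecreasing (`mono`), so Gaussian bounds on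
`u_j` pass to `B(𝐮)`, and L5 with homogeneity makes the bound integrable.

In the equality case `Q = 0`, and a semidefinite form vanishes only on the kernel of its matrix,
which gives the stated vector equation. -/

open Filter Topology

/-! ### Moments against Gaussians and their derivatives -/

/-- The moment `∫ u(s) (y - s)^m e^{-τ (y - s)²} ds` of `u` against a Gaussian centred at `y`. -/
noncomputable def gaussMoment (u : ℝ → ℝ) (m : ℕ) (y τ : ℝ) : ℝ :=
  ∫ s, u s * ((y - s) ^ m * Real.exp (-τ * (y - s) ^ 2))

/-- A bound for `|z|^m e^{-τ z²}`. -/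
noncomputable def gaussMomentBound (m : ℕ) (τ : ℝ) : ℝ := 1 + m.factorial / τ ^ m

/-- A single bound valid for all `τ ≥ τ₀`, so that it can dominate when `τ` varies. It follows from
`|z|^m ≤ 1 + z^{2m}` and `x^m / m! ≤ e^x` at `x = τ₀ z²`. -/
theorem abs_pow_mul_exp_le (m : ℕ) {τ₀ τ : ℝ} (h₀ : 0 < τ₀) (h : τ₀ ≤ τ) (z : ℝ) :
    |z ^ m * Real.exp (-τ * z ^ 2)| ≤ gaussMomentBound m τ₀ := by
  have h1 : |z| ^ m ≤ 1 + (z ^ 2) ^ m := by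
    rcases le_total |z| 1 with hz | hz
    · exact (pow_le_one₀ (abs_nonneg z) hz).trans (by have : 0 ≤ (z ^ 2) ^ m := by positivity
                                                      linarith)
    · rw [← sq_abs, ← pow_mul]
      have := pow_le_pow_right₀ hz (show m ≤ 2 * m by omega)
      linarith
  have h2 : (τ₀ * z ^ 2) ^ m / m.factorial ≤ Real.exp (τ₀ * z ^ 2) :=
    Real.pow_div_factorial_le_exp _ (by positivity) m
  have h3 : Real.exp (-τ * z ^ 2) ≤ Real.exp (-(τ₀ * z ^ 2)) := by
    apply Real.exp_le_exp.2
    nlinarith [sq_nonneg z]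
  have h4 : (z ^ 2) ^ m * Real.exp (-(τ₀ * z ^ 2)) ≤ m.factorial / τ₀ ^ m := by
    rw [Real.exp_neg, ← div_eq_mul_inv, div_le_div_iff₀ (Real.exp_pos _) (by positivity)]
    rw [div_le_iff₀ (by positivity), mul_pow] at h2
    nlinarith
  have h5 : Real.exp (-(τ₀ * z ^ 2)) ≤ 1 := Real.exp_le_one_iff.2 (by
    have : 0 ≤ τ₀ * z ^ 2 := by positivity
    linarith)
  rw [abs_mul, abs_pow, abs_of_pos (Real.exp_pos _), gaussMomentBound]
  calc |z| ^ m * Real.exp (-τ * z ^ 2)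
      ≤ (1 + (z ^ 2) ^ m) * Real.exp (-(τ₀ * z ^ 2)) := by gcongr
    _ = Real.exp (-(τ₀ * z ^ 2)) + (z ^ 2) ^ m * Real.exp (-(τ₀ * z ^ 2)) := by ring
    _ ≤ _ := by linarith

theorem gaussMomentBound_nonneg (m : ℕ) {τ : ℝ} (h : 0 < τ) : 0 ≤ gaussMomentBound m τ := by
  unfold gaussMomentBound; positivity

section Moments

variable {u : ℝ → ℝ}

theorem aestronglyMeasurable_gaussMoment_integrand (hu : Integrable u) (m : ℕ) (y τ : ℝ) :
    AEStronglyMeasurable (fun s => u s * ((y - s) ^ m * Real.exp (-τ * (y - s) ^ 2))) :=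
  hu.aestronglyMeasurable.mul (by fun_prop : Continuous fun s : ℝ =>
    (y - s) ^ m * Real.exp (-τ * (y - s) ^ 2)).aestronglyMeasurable

theorem norm_gaussMoment_integrand_le (u : ℝ → ℝ) (m : ℕ) {τ₀ τ : ℝ} (h₀ : 0 < τ₀) (h : τ₀ ≤ τ)
    (y s : ℝ) : ‖u s * ((y - s) ^ m * Real.exp (-τ * (y - s) ^ 2))‖ ≤
      |u s| * gaussMomentBound m τ₀ := by
  rw [norm_mul, Real.norm_eq_abs, Real.norm_eq_abs]
  exact mul_le_mul_of_nonneg_left (abs_pow_mul_exp_le m h₀ h _) (abs_nonneg _)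

theorem integrable_gaussMoment_integrand (hu : Integrable u) (m : ℕ) (y : ℝ) {τ : ℝ} (h : 0 < τ) :
    Integrable (fun s => u s * ((y - s) ^ m * Real.exp (-τ * (y - s) ^ 2))) :=
  (hu.abs.mul_const (gaussMomentBound m τ)).mono'
    (aestronglyMeasurable_gaussMoment_integrand hu m y τ)
    (ae_of_all _ fun s => norm_gaussMoment_integrand_le u m h le_rfl y s)

theorem continuousAt_gaussMoment (hu : Integrable u) (m : ℕ) {p : ℝ × ℝ} (hp : 0 < p.2) :
    ContinuousAt (fun p : ℝ × ℝ => gaussMoment u m p.1 p.2) p := by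
  unfold gaussMoment
  refine continuousAt_of_dominated (bound := fun s => |u s| * gaussMomentBound m (p.2 / 2))
    (Eventually.of_forall fun q => aestronglyMeasurable_gaussMoment_integrand hu m q.1 q.2) ?_
    (hu.abs.mul_const _) (ae_of_all _ fun s => by fun_prop)
  have : ∀ᶠ q : ℝ × ℝ in 𝓝 p, p.2 / 2 < q.2 :=
    continuous_snd.continuousAt.eventually (lt_mem_nhds (by linarith))
  filter_upwards [this] with q hq
  exact ae_of_all _ fun s => norm_gaussMoment_integrand_le u m (by linarith) hq.le _ s

theorem hasDerivAt_gaussMoment_left (hu : Integrable u) (m : ℕ) (y : ℝ) {τ : ℝ} (h : 0 < τ) :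
    HasDerivAt (fun y => gaussMoment u m y τ)
      -- For `m = 0` the truncated `m - 1` is harmless, since its coefficient is zero.
      (m * gaussMoment u (m - 1) y τ - 2 * τ * gaussMoment u (m + 1) y τ) y := by
  have key := (hasDerivAt_integral_of_dominated_loc_of_deriv_le (μ := volume) (s := Set.univ)
    (x₀ := y)
    (F := fun y s => u s * ((y - s) ^ m * Real.exp (-τ * (y - s) ^ 2)))
    (F' := fun y s => m * (u s * ((y - s) ^ (m - 1) * Real.exp (-τ * (y - s) ^ 2))) -
      2 * τ * (u s * ((y - s) ^ (m + 1) * Real.exp (-τ * (y - s) ^ 2))))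
    (bound := fun s => m * (|u s| * gaussMomentBound (m - 1) τ) +
      2 * τ * (|u s| * gaussMomentBound (m + 1) τ))
    univ_mem
    (Eventually.of_forall fun q => aestronglyMeasurable_gaussMoment_integrand hu m q τ)
    (integrable_gaussMoment_integrand hu m y h)
    (((aestronglyMeasurable_gaussMoment_integrand hu (m - 1) y τ).const_mul _).sub
      ((aestronglyMeasurable_gaussMoment_integrand hu (m + 1) y τ).const_mul _))
    (ae_of_all _ fun s q _ => ?_)
    (((hu.abs.mul_const _).const_mul _).add ((hu.abs.mul_const _).const_mul _))
    (ae_of_all _ fun s q _ => ?_)).2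
  · rw [integral_sub ((integrable_gaussMoment_integrand hu (m - 1) y h).const_mul _)
      ((integrable_gaussMoment_integrand hu (m + 1) y h).const_mul _),
      integral_const_mul, integral_const_mul] at key
    exact key
  · refine (norm_sub_le _ _).trans ?_
    rw [norm_mul, norm_mul (2 * τ), Real.norm_of_nonneg (Nat.cast_nonneg m),
      Real.norm_of_nonneg (by positivity : 0 ≤ 2 * τ)]
    gcongr
    · exact norm_gaussMoment_integrand_le u (m - 1) h le_rfl q s
    · exact norm_gaussMoment_integrand_le u (m + 1) h le_rfl q s
  · have h1 : HasDerivAt (fun y : ℝ => y - s) 1 q := (hasDerivAt_id q).sub_const s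
    have h2 := ((h1.pow m).mul (((h1.pow 2).const_mul (-τ)).exp)).const_mul (u s)
    refine h2.congr_deriv ?_
    simp only [Pi.pow_apply]
    push_cast
    ring

theorem hasDerivAt_gaussMoment_right (hu : Integrable u) (m : ℕ) (y : ℝ) {τ : ℝ} (h : 0 < τ) :
    HasDerivAt (fun τ => gaussMoment u m y τ) (-gaussMoment u (m + 2) y τ) τ := by
  have key := (hasDerivAt_integral_of_dominated_loc_of_deriv_le (μ := volume)
    -- Keeping the parameter above `τ / 2` lets one moment bound dominate on the whole
    -- neighbourhood.
    (s := Set.Ioi (τ / 2)) (x₀ := τ)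
    (F := fun τ s => u s * ((y - s) ^ m * Real.exp (-τ * (y - s) ^ 2)))
    (F' := fun τ s => -(u s * ((y - s) ^ (m + 2) * Real.exp (-τ * (y - s) ^ 2))))
    (bound := fun s => |u s| * gaussMomentBound (m + 2) (τ / 2))
    (Ioi_mem_nhds (by linarith))
    (Eventually.of_forall fun q => aestronglyMeasurable_gaussMoment_integrand hu m y q)
    (integrable_gaussMoment_integrand hu m y h)
    (aestronglyMeasurable_gaussMoment_integrand hu (m + 2) y τ).neg
    (ae_of_all _ fun s q hq => ?_)
    (hu.abs.mul_const _)
    (ae_of_all _ fun s q _ => ?_)).2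
  · rwa [integral_neg] at key
  · rw [norm_neg]
    exact norm_gaussMoment_integrand_le u (m + 2) (by linarith) (le_of_lt hq) y s
  · have h1 : HasDerivAt (fun τ : ℝ => -τ) (-1) q := (hasDerivAt_id q).neg
    have h2 := (((h1.mul_const ((y - s) ^ 2)).exp).const_mul ((y - s) ^ m)).const_mul (u s)
    refine h2.congr_deriv ?_
    ring

end Moments

/-! ### The heat extension: equation, continuity, positivity -/

section Heat

variable {σ : ℝ} {u : ℝ → ℝ}

theorem heatExtension_eq_gaussMoment (σ : ℝ) (u : ℝ → ℝ) (y t : ℝ) :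
    heatExtension σ u y t =
      1 / Real.sqrt (4 * Real.pi * t * σ) * gaussMoment u 0 y (1 / (4 * t * σ)) := by
  unfold heatExtension gaussMoment
  congr 1
  apply integral_congr_ae (ae_of_all _ fun s => ?_)
  simp only [pow_zero, one_mul]
  congr 2
  ring

/-- The space derivative of the heat extension. -/
noncomputable def heatDeriv (σ : ℝ) (u : ℝ → ℝ) (y t : ℝ) : ℝ :=
  1 / Real.sqrt (4 * Real.pi * t * σ) *
    (-(2 * (1 / (4 * t * σ))) * gaussMoment u 1 y (1 / (4 * t * σ)))

/-- The second space derivative of the heat extension. -/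
noncomputable def heatDeriv₂ (σ : ℝ) (u : ℝ → ℝ) (y t : ℝ) : ℝ :=
  1 / Real.sqrt (4 * Real.pi * t * σ) * (-(2 * (1 / (4 * t * σ))) *
    (gaussMoment u 0 y (1 / (4 * t * σ)) -
      2 * (1 / (4 * t * σ)) * gaussMoment u 2 y (1 / (4 * t * σ))))

theorem hasDerivAt_heatExtension (hσ : 0 < σ) (hu : Integrable u) (y : ℝ) {t : ℝ} (ht : 0 < t) :
    HasDerivAt (fun y => heatExtension σ u y t) (heatDeriv σ u y t) y := by
  simp only [heatExtension_eq_gaussMoment]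
  refine ((hasDerivAt_gaussMoment_left hu 0 y (τ := 1 / (4 * t * σ))
    (by positivity)).const_mul _).congr_deriv ?_
  simp [heatDeriv]

theorem hasDerivAt_heatDeriv (hσ : 0 < σ) (hu : Integrable u) (y : ℝ) {t : ℝ} (ht : 0 < t) :
    HasDerivAt (fun y => heatDeriv σ u y t) (heatDeriv₂ σ u y t) y := by
  refine (((hasDerivAt_gaussMoment_left hu 1 y (τ := 1 / (4 * t * σ))
    (by positivity)).const_mul _).const_mul _).congr_deriv ?_
  simp [heatDeriv₂]

/-- The heat equation. The prefactor produces the moment of order 0, the change of `τ = 1/(4tσ)` the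
moment of order 2, in the combination found in `heatDeriv₂`. -/
theorem hasDerivAt_heatExtension_time (hσ : 0 < σ) (hu : Integrable u) (y : ℝ) {t : ℝ}
    (ht : 0 < t) :
    HasDerivAt (fun t => heatExtension σ u y t) (σ * heatDeriv₂ σ u y t) t := by
  simp only [heatExtension_eq_gaussMoment]
  have h1 : HasDerivAt (fun t : ℝ => 4 * t * σ) (4 * σ) t := by
    simpa using ((hasDerivAt_id t).const_mul 4).mul_const σ
  have h2 : HasDerivAt (fun t : ℝ => 1 / (4 * t * σ)) (-(4 * σ) / (4 * t * σ) ^ 2) t := by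
    simpa using h1.fun_inv (by positivity)
  have h3 : HasDerivAt (fun t : ℝ => 4 * Real.pi * t * σ) (4 * Real.pi * σ) t := by
    simpa using ((hasDerivAt_id t).const_mul (4 * Real.pi)).mul_const σ
  have hpos : 0 < 4 * Real.pi * t * σ := by positivity
  have hsq : Real.sqrt (4 * Real.pi * t * σ) ^ 2 = 4 * Real.pi * t * σ := Real.sq_sqrt hpos.le
  have hs : 0 < Real.sqrt (4 * Real.pi * t * σ) := Real.sqrt_pos.2 hpos
  have h4 : HasDerivAt (fun t : ℝ => 1 / Real.sqrt (4 * Real.pi * t * σ))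
      (-(1 / (2 * t)) * (1 / Real.sqrt (4 * Real.pi * t * σ))) t := by
    have := (h3.sqrt hpos.ne').fun_inv hs.ne'
    simp only [← one_div] at this
    refine this.congr_deriv ?_
    rw [hsq]
    field_simp
  have h5 : HasDerivAt (fun t : ℝ => gaussMoment u 0 y (1 / (4 * t * σ)))
      (-gaussMoment u 2 y (1 / (4 * t * σ)) * (-(4 * σ) / (4 * t * σ) ^ 2)) t :=
    HasDerivAt.comp (h₂ := fun τ => gaussMoment u 0 y τ) t
      (hasDerivAt_gaussMoment_right hu 0 y (τ := 1 / (4 * t * σ)) (by positivity)) h2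
  refine (h4.mul h5).congr_deriv ?_
  simp only [heatDeriv₂]
  field_simp
  ring

theorem continuousAt_gaussMoment_heat (hσ : 0 < σ) (hu : Integrable u) (m : ℕ) {p : ℝ × ℝ}
    (hp : 0 < p.2) :
    ContinuousAt (fun p : ℝ × ℝ => gaussMoment u m p.1 (1 / (4 * p.2 * σ))) p := by
  have h : ContinuousAt (fun p : ℝ × ℝ => (p.1, 1 / (4 * p.2 * σ))) p := by
    refine continuousAt_fst.prodMk (continuousAt_const.div (by fun_prop) (by positivity))
  exact ContinuousAt.comp (f := fun p : ℝ × ℝ => (p.1, 1 / (4 * p.2 * σ)))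
    (g := fun p : ℝ × ℝ => gaussMoment u m p.1 p.2)
    (continuousAt_gaussMoment hu m (by simp only; positivity)) h

theorem continuousAt_heatExtension (hσ : 0 < σ) (hu : Integrable u) {p : ℝ × ℝ} (hp : 0 < p.2) :
    ContinuousAt (fun p : ℝ × ℝ => heatExtension σ u p.1 p.2) p := by
  simp only [heatExtension_eq_gaussMoment]
  refine ContinuousAt.mul (continuousAt_const.div (by fun_prop) ?_)
    (continuousAt_gaussMoment_heat hσ hu 0 hp)
  exact (Real.sqrt_pos.2 (by positivity)).ne'

theorem continuousAt_heatDeriv (hσ : 0 < σ) (hu : Integrable u) {p : ℝ × ℝ} (hp : 0 < p.2) :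
    ContinuousAt (fun p : ℝ × ℝ => heatDeriv σ u p.1 p.2) p := by
  refine ContinuousAt.mul (continuousAt_const.div (by fun_prop) ?_)
    (ContinuousAt.mul (ContinuousAt.neg (continuousAt_const.mul
      (continuousAt_const.div (by fun_prop) (by positivity))))
    (continuousAt_gaussMoment_heat hσ hu 1 hp))
  exact (Real.sqrt_pos.2 (by positivity)).ne'

theorem continuousAt_heatDeriv₂ (hσ : 0 < σ) (hu : Integrable u) {p : ℝ × ℝ} (hp : 0 < p.2) :
    ContinuousAt (fun p : ℝ × ℝ => heatDeriv₂ σ u p.1 p.2) p := by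
  have h1 : ContinuousAt (fun p : ℝ × ℝ => 1 / (4 * p.2 * σ)) p :=
    continuousAt_const.div (by fun_prop) (by positivity)
  refine ContinuousAt.mul (continuousAt_const.div (by fun_prop) ?_)
    (ContinuousAt.mul (continuousAt_const.mul h1).neg
    ((continuousAt_gaussMoment_heat hσ hu 0 hp).sub
      ((continuousAt_const.mul h1).mul (continuousAt_gaussMoment_heat hσ hu 2 hp))))
  exact (Real.sqrt_pos.2 (by positivity)).ne'

theorem heatExtension_pos (hσ : 0 < σ) (hu : Integrable u) (h0 : ∀ y, 0 ≤ u y)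
    (hpos : 0 < ∫ y, u y) (y : ℝ) {t : ℝ} (ht : 0 < t) : 0 < heatExtension σ u y t := by
  rw [heatExtension_eq_gaussMoment]
  have : 0 < Real.sqrt (4 * Real.pi * t * σ) := Real.sqrt_pos.2 (by positivity)
  refine mul_pos (by positivity) ?_
  unfold gaussMoment
  rw [integral_pos_iff_support_of_nonneg (fun s => ?_)
    (integrable_gaussMoment_integrand hu 0 y (by positivity))]
  -- The Gaussian never vanishes, so the integrand has the same support as `u`.
  · rw [integral_pos_iff_support_of_nonneg h0 hu] at hpos
    convert hpos using 2
    ext s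
    simp [Real.exp_ne_zero]
  · have := h0 s
    simp only [Pi.zero_apply, pow_zero, one_mul]
    positivity

end Heat

/-! ### Gaussian bounds and the long-time limit in one dimension -/

theorem integrable_gaussian_sub {δ : ℝ} (hδ : 0 < δ) (c : ℝ) :
    Integrable fun s : ℝ => Real.exp (-δ * (s - c) ^ 2) :=
  (integrable_exp_neg_mul_sq hδ).comp_sub_right c

theorem GaussianDecay.integrable {u : ℝ → ℝ} (hu : GaussianDecay u) : Integrable u := by
  obtain ⟨hm, b, -, δ, hδ, h⟩ := hu
  exact ((integrable_exp_neg_mul_sq hδ).const_mul b).mono' hm.aestronglyMeasurable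
    (ae_of_all _ h)

section Bounds

variable {σ : ℝ} {u : ℝ → ℝ} {b δ : ℝ}

theorem integral_gaussian_mul_gaussian {δ β : ℝ} (hδ : 0 < δ) (hβ : 0 < β) (y : ℝ) :
    ∫ s : ℝ, Real.exp (-δ * s ^ 2) * Real.exp (-β * (y - s) ^ 2) =
      Real.exp (-(δ * β / (δ + β)) * y ^ 2) * Real.sqrt (Real.pi / (δ + β)) := by
  -- Completing the square in `s`.
  have h : ∀ s : ℝ, Real.exp (-δ * s ^ 2) * Real.exp (-β * (y - s) ^ 2) =
      Real.exp (-(δ * β / (δ + β)) * y ^ 2) *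
        Real.exp (-(δ + β) * (s - β * y / (δ + β)) ^ 2) := by
    intro s
    rw [← Real.exp_add, ← Real.exp_add]
    congr 1
    have : δ + β ≠ 0 := by positivity
    field_simp
    ring
  simp only [h]
  rw [integral_const_mul,
    integral_sub_right_eq_self (fun s : ℝ => Real.exp (-(δ + β) * s ^ 2)) (β * y / (δ + β)),
    integral_gaussian]

/-- The heat flow preserves order and sends Gaussians to Gaussians; with `β = 1/(4tσ)` the new
exponent is `δβ/(δ+β)`. -/
theorem heatExtension_le (hσ : 0 < σ) (hδ : 0 < δ) (hu : Integrable u)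
    (hle : ∀ y, u y ≤ b * Real.exp (-δ * y ^ 2)) (y : ℝ) {t : ℝ} (ht : 0 < t) :
    heatExtension σ u y t ≤ b * Real.sqrt (1 / (4 * t * σ) / (δ + 1 / (4 * t * σ))) *
      Real.exp (-(δ * (1 / (4 * t * σ)) / (δ + 1 / (4 * t * σ))) * y ^ 2) := by
  rw [heatExtension_eq_gaussMoment]
  have hc : 1 / Real.sqrt (4 * Real.pi * t * σ) = Real.sqrt (1 / (4 * t * σ) / Real.pi) := by
    rw [← Real.sqrt_one, ← Real.sqrt_div zero_le_one, Real.sqrt_one]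
    congr 1
    field_simp
  rw [hc]
  have hβ : 0 < 1 / (4 * t * σ) := by positivity
  generalize 1 / (4 * t * σ) = β at hβ ⊢
  have h1 : gaussMoment u 0 y β ≤
      b * (Real.exp (-(δ * β / (δ + β)) * y ^ 2) * Real.sqrt (Real.pi / (δ + β))) := by
    rw [← integral_gaussian_mul_gaussian hδ hβ, ← integral_const_mul]
    refine integral_mono (integrable_gaussMoment_integrand hu 0 y hβ) ?_ fun s => ?_
    · refine (((integrable_exp_neg_mul_sq hδ).mono' (by fun_prop)
        (ae_of_all _ fun s => ?_))).const_mul b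
      rw [norm_mul, Real.norm_eq_abs, Real.norm_eq_abs, Real.abs_exp, Real.abs_exp]
      refine mul_le_of_le_one_right (Real.exp_pos _).le (Real.exp_le_one_iff.2 ?_)
      nlinarith [sq_nonneg (y - s)]
    · simp only [pow_zero, one_mul]
      rw [← mul_assoc]
      exact mul_le_mul_of_nonneg_right (hle s) (Real.exp_pos _).le
  have h2 : Real.sqrt (β / (δ + β)) =
      Real.sqrt (β / Real.pi) * Real.sqrt (Real.pi / (δ + β)) := by
    rw [← Real.sqrt_mul (by positivity)]
    congr 1
    field_simp
  rw [h2]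
  calc Real.sqrt (β / Real.pi) * gaussMoment u 0 y β ≤ Real.sqrt (β / Real.pi) *
        (b * (Real.exp (-(δ * β / (δ + β)) * y ^ 2) * Real.sqrt (Real.pi / (δ + β)))) := by gcongr
    _ = _ := by ring

theorem heatExtension_le_of_time_le (hσ : 0 < σ) (hb : 0 < b) (hδ : 0 < δ) (hu : Integrable u)
    (hle : ∀ y, u y ≤ b * Real.exp (-δ * y ^ 2)) {T : ℝ} (hT : 0 < T) :
    ∃ δ' > 0, ∀ t, 0 < t → t ≤ T → ∀ y,
      heatExtension σ u y t ≤ b * Real.exp (-δ' * y ^ 2) := by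
  -- The exponent `δβ/(δ+β)` increases with `β`, hence is smallest at the final time `T`; the
  -- amplitude factor is at most 1.
  refine ⟨δ * (1 / (4 * T * σ)) / (δ + 1 / (4 * T * σ)), by positivity, fun t ht htT y => ?_⟩
  refine (heatExtension_le hσ hδ hu hle y ht).trans ?_
  have hβ : 1 / (4 * T * σ) ≤ 1 / (4 * t * σ) := by gcongr
  have hβ' : 0 < 1 / (4 * T * σ) := by positivity
  generalize 1 / (4 * T * σ) = β' at hβ hβ' ⊢
  generalize 1 / (4 * t * σ) = β at hβ ⊢
  have hβ0 := hβ'.trans_le hβ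
  have h1 : Real.sqrt (β / (δ + β)) ≤ 1 := by
    rw [Real.sqrt_le_one, div_le_one (by positivity)]
    linarith
  have h2 : δ * β' / (δ + β') ≤ δ * β / (δ + β) := by
    rw [div_le_div_iff₀ (by positivity) (by positivity)]
    nlinarith [mul_le_mul_of_nonneg_left hβ (sq_nonneg δ)]
  calc b * Real.sqrt (β / (δ + β)) * Real.exp (-(δ * β / (δ + β)) * y ^ 2)
      ≤ b * 1 * Real.exp (-(δ * β' / (δ + β')) * y ^ 2) := by
        gcongr
    _ = _ := by ring

theorem rescaled_heatExtension_le (hσ : 0 < σ) (hb : 0 < b) (hδ : 0 < δ) (hu : Integrable u)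
    (hle : ∀ y, u y ≤ b * Real.exp (-δ * y ^ 2)) :
    ∃ b' > 0, ∃ δ' > 0, ∀ t, 1 ≤ t → ∀ y,
      2 * Real.sqrt t * heatExtension σ u (2 * Real.sqrt t * y) t ≤
        b' * Real.exp (-δ' * y ^ 2) := by
  -- After rescaling the exponent is `δ/(σ(δ+β))`, worst at `t = 1` where `β = 1/(4σ)`; the
  -- amplitude `√(1/(σ(δ+β)))` is bounded by dropping `β`.
  refine ⟨b * Real.sqrt (1 / (σ * δ)), by positivity, δ / (σ * (δ + 1 / (4 * σ))), by positivity,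
    fun t ht y => ?_⟩
  have ht0 : 0 < t := by linarith
  have h4 : 2 * Real.sqrt t = Real.sqrt (4 * t) := by
    rw [Real.sqrt_mul (by norm_num), show (4 : ℝ) = 2 ^ 2 by norm_num,
      Real.sqrt_sq (by norm_num)]
  rw [h4]
  calc Real.sqrt (4 * t) * heatExtension σ u (Real.sqrt (4 * t) * y) t
      ≤ Real.sqrt (4 * t) * (b * Real.sqrt (1 / (4 * t * σ) / (δ + 1 / (4 * t * σ))) *
        Real.exp (-(δ * (1 / (4 * t * σ)) / (δ + 1 / (4 * t * σ))) *
          (Real.sqrt (4 * t) * y) ^ 2)) := by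
        gcongr
        exact heatExtension_le hσ hδ hu hle _ ht0
    _ = b * (Real.sqrt (4 * t) * Real.sqrt (1 / (4 * t * σ) / (δ + 1 / (4 * t * σ)))) *
        Real.exp (-(δ / (σ * (δ + 1 / (4 * t * σ)))) * y ^ 2) := by
        rw [mul_pow, Real.sq_sqrt (by positivity)]
        have : -(δ * (1 / (4 * t * σ)) / (δ + 1 / (4 * t * σ))) * (4 * t * y ^ 2) =
            -(δ / (σ * (δ + 1 / (4 * t * σ)))) * y ^ 2 := by
          field_simp
        rw [this]
        ring
    _ ≤ _ := by
        rw [← Real.sqrt_mul (by positivity)]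
        have h1 : 4 * t * (1 / (4 * t * σ) / (δ + 1 / (4 * t * σ))) ≤ 1 / (σ * δ) := by
          rw [show 4 * t * (1 / (4 * t * σ) / (δ + 1 / (4 * t * σ))) =
            1 / (σ * (δ + 1 / (4 * t * σ))) by field_simp]
          gcongr
          linarith [show 0 < 1 / (4 * t * σ) by positivity]
        have h2 : δ / (σ * (δ + 1 / (4 * σ))) ≤ δ / (σ * (δ + 1 / (4 * t * σ))) := by
          gcongr
          linarith
        gcongr

end Bounds

/-- The factor `2√t` cancels the decay of the kernel's prefactor, and the rescaled kernel `exp(-(y -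
s/(2√t))²/σ)` loses its dependence on `s` in the limit, so only the mass of `u` survives. -/
theorem tendsto_rescaled_heatExtension {σ : ℝ} {u : ℝ → ℝ} (hσ : 0 < σ) (hu : Integrable u)
    (y : ℝ) :
    Tendsto (fun t => 2 * Real.sqrt t * heatExtension σ u (2 * Real.sqrt t * y) t) atTop
      (𝓝 (gaussianOfMass σ u y)) := by
  have h1 : ∀ᶠ t : ℝ in atTop,
      1 / Real.sqrt (Real.pi * σ) * ∫ s, u s * Real.exp (-(y - s / (2 * Real.sqrt t)) ^ 2 / σ) =
      2 * Real.sqrt t * heatExtension σ u (2 * Real.sqrt t * y) t := by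
    filter_upwards [eventually_gt_atTop 0] with t ht
    unfold heatExtension
    rw [show 4 * Real.pi * t * σ = 2 ^ 2 * t * (Real.pi * σ) by ring,
      Real.sqrt_mul (by positivity) (Real.pi * σ), Real.sqrt_mul (by positivity) t,
      Real.sqrt_sq (by norm_num)]
    have hs : 0 < Real.sqrt t := Real.sqrt_pos.2 ht
    have hs2 : t = Real.sqrt t ^ 2 := (Real.sq_sqrt ht.le).symm
    rw [← mul_assoc]
    congr 1
    · field_simp
    · refine integral_congr_ae (ae_of_all _ fun s => ?_)
      simp only
      congr 2
      have : 4 * t * σ = 4 * Real.sqrt t ^ 2 * σ := by rw [← hs2]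
      rw [this]
      field_simp
      ring
  refine Tendsto.congr' h1 ?_
  have h2 : gaussianOfMass σ u y =
      1 / Real.sqrt (Real.pi * σ) * ∫ s, u s * Real.exp (-(y - 0) ^ 2 / σ) := by
    rw [gaussianOfMass, integral_mul_const, sub_zero]
    ring
  rw [h2]
  refine Tendsto.const_mul _ (tendsto_integral_filter_of_dominated_convergence (fun s => |u s|)
    (Eventually.of_forall fun t => ?_) (Eventually.of_forall fun t => ae_of_all _ fun s => ?_)
    hu.abs (ae_of_all _ fun s => ?_))
  · exact hu.aestronglyMeasurable.mul (by fun_prop : Continuous fun s : ℝ =>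
      Real.exp (-(y - s / (2 * Real.sqrt t)) ^ 2 / σ)).aestronglyMeasurable
  · rw [norm_mul, Real.norm_eq_abs, Real.norm_eq_abs, Real.abs_exp]
    refine mul_le_of_le_one_right (abs_nonneg _) (Real.exp_le_one_iff.2 ?_)
    rw [neg_div]
    exact neg_nonpos.2 (by positivity)
  · have h3 : Tendsto (fun t : ℝ => s / (2 * Real.sqrt t)) atTop (𝓝 0) :=
      tendsto_const_nhds.div_atTop
        (Tendsto.const_mul_atTop two_pos Real.tendsto_sqrt_atTop)
    exact ((((tendsto_const_nhds.sub h3).pow 2).neg.div_const σ).rexp).const_mul _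

/-! ### Almost everywhere convergence to the initial value -/

section InitialValue

variable {u : ℝ → ℝ} {b : ℝ}

theorem abs_primitive_sub_le (hu : Integrable u) (hb : ∀ y, |u y| ≤ b) (c y z : ℝ) :
    |(∫ t in c..y, u t) - ∫ t in c..z, u t| ≤ b * |y - z| := by
  rw [intervalIntegral.integral_interval_sub_left hu.intervalIntegrable hu.intervalIntegrable]
  exact intervalIntegral.norm_integral_le_of_norm_le_const (f := u) fun x _ => hb x

theorem abs_primitive_le (hu : Integrable u) (c y : ℝ) :
    |∫ t in c..y, u t| ≤ ∫ t, |u t| := by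
  refine (intervalIntegral.norm_integral_le_integral_norm_uIoc (f := u)).trans ?_
  exact setIntegral_le_integral hu.norm (ae_of_all _ fun _ => norm_nonneg _)

theorem continuous_primitive_of_integrable (hu : Integrable u) (c : ℝ) :
    Continuous fun y => ∫ t in c..y, u t :=
  intervalIntegral.continuous_primitive (fun _ _ => hu.intervalIntegrable) c

/-- Integration by parts against a Gaussian. -/
theorem integral_mul_gaussian_eq_primitive (hu : Integrable u) (hb : ∀ y, |u y| ≤ b) {β : ℝ}
    (hβ : 0 < β) (c x : ℝ) :
    ∫ s, u s * Real.exp (-β * (x - s) ^ 2) =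
      ∫ s, (∫ t in c..s, u t) * (-2 * β * (x - s) * Real.exp (-β * (x - s) ^ 2)) := by
  set V : ℝ → ℝ := fun y => ∫ t in c..y, u t with hV
  have hVc : Continuous V := continuous_primitive_of_integrable hu c
  have hb0 : 0 ≤ b := (abs_nonneg _).trans (hb 0)
  set M := ∫ t, |u t| with hM
  have hM0 : 0 ≤ M := integral_nonneg fun _ => abs_nonneg _
  have hint : ∀ x, Integrable fun s => V s * Real.exp (-β * (x - s) ^ 2) := by
    intro x
    refine ((integrable_gaussian_sub hβ x).const_mul M).mono' (by fun_prop)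
      (ae_of_all _ fun s => ?_)
    rw [norm_mul, Real.norm_eq_abs, Real.norm_eq_abs, Real.abs_exp,
      show (x - s) ^ 2 = (s - x) ^ 2 by ring]
    gcongr
    exact abs_primitive_le hu c s
  -- The convolution of `V` with the Gaussian is differentiated twice over, once on each factor, and
  -- the results are equated. Here the derivative falls on `V`, which is Lipschitz and has
  -- derivative `u` almost everywhere.
  have h1 : HasDerivAt (fun x => ∫ s, V (x - s) * Real.exp (-β * s ^ 2))
      (∫ s, u (x - s) * Real.exp (-β * s ^ 2)) x := by
    refine (hasDerivAt_integral_of_dominated_loc_of_lip (μ := volume) (s := Set.univ)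
      (F := fun x s => V (x - s) * Real.exp (-β * s ^ 2))
      (bound := fun s => b * Real.exp (-β * s ^ 2)) univ_mem
      (Eventually.of_forall fun x => by fun_prop) ?_ ?_ (ae_of_all _ fun s => ?_)
      ((integrable_exp_neg_mul_sq hβ).const_mul b) ?_).2
    · have := (hint x).comp_sub_left x
      simpa only [sub_sub_cancel] using this
    · exact (hu.comp_sub_left x).aestronglyMeasurable.mul (by fun_prop)
    · refine LipschitzOnWith.of_dist_le_mul fun y _ z _ => ?_
      rw [Real.dist_eq, Real.dist_eq, ← sub_mul, abs_mul, Real.abs_exp, Real.coe_nnabs,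
        abs_of_nonneg (by positivity : 0 ≤ b * Real.exp (-β * s ^ 2))]
      calc |V (y - s) - V (z - s)| * Real.exp (-β * s ^ 2)
          ≤ (b * |(y - s) - (z - s)|) * Real.exp (-β * s ^ 2) := by
            gcongr
            exact abs_primitive_sub_le hu hb c _ _
        _ = _ := by rw [sub_sub_sub_cancel_right]; ring
    · have := (quasiMeasurePreserving_sub_left volume x).ae
        (LocallyIntegrable.ae_hasDerivAt_integral hu.locallyIntegrable)
      filter_upwards [this] with s hs
      exact (HasDerivAt.comp_sub_const x s (hs c)).mul_const _
  -- Here it falls on the Gaussian. Half of the exponent absorbs the factor `|y - s|`; the other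
  -- half is compared with a Gaussian centred at `x` through `(s-x)² ≤ 2(y-s)² + 2`, whence the
  -- constant `exp(β/2)`.
  have h2 : HasDerivAt (fun x => ∫ s, V s * Real.exp (-β * (x - s) ^ 2))
      (∫ s, V s * (-2 * β * (x - s) * Real.exp (-β * (x - s) ^ 2))) x := by
    refine (hasDerivAt_integral_of_dominated_loc_of_deriv_le (μ := volume)
      (s := Metric.ball x 1)
      (F := fun x s => V s * Real.exp (-β * (x - s) ^ 2))
      (F' := fun x s => V s * (-2 * β * (x - s) * Real.exp (-β * (x - s) ^ 2)))
      (bound := fun s => M * (2 * β * gaussMomentBound 1 (β / 2) * Real.exp (β / 2)) *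
        Real.exp (-(β / 4) * (s - x) ^ 2)) (Metric.ball_mem_nhds x one_pos)
      (Eventually.of_forall fun x => by fun_prop) (hint x) (by fun_prop)
      (ae_of_all _ fun s y hy => ?_)
      ((integrable_gaussian_sub (by positivity) x).const_mul _)
      (ae_of_all _ fun s y _ => ?_)).2
    · have hyx : (y - x) ^ 2 ≤ 1 := by
        rw [sq_le_one_iff_abs_le_one, ← Real.dist_eq]
        exact (Metric.mem_ball.1 hy).le
      have hbd := abs_pow_mul_exp_le 1 (τ₀ := β / 2) (by positivity) le_rfl (y - s)
      rw [pow_one, abs_mul, Real.abs_exp] at hbd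
      have he : Real.exp (-β * (y - s) ^ 2) =
          Real.exp (-(β / 2) * (y - s) ^ 2) * Real.exp (-(β / 2) * (y - s) ^ 2) := by
        rw [← Real.exp_add]; congr 1; ring
      have he2 : Real.exp (-(β / 2) * (y - s) ^ 2) ≤
          Real.exp (β / 2) * Real.exp (-(β / 4) * (s - x) ^ 2) := by
        rw [← Real.exp_add]
        apply Real.exp_le_exp.2
        nlinarith [sq_nonneg ((y - s) + (y - x)), sq_nonneg ((y - s) - (y - x))]
      have hG := gaussMomentBound_nonneg 1 (half_pos hβ)
      rw [he, norm_mul, norm_mul, norm_mul, norm_mul, Real.norm_eq_abs, Real.norm_eq_abs,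
        Real.norm_eq_abs, Real.norm_eq_abs, Real.norm_eq_abs, abs_mul (Real.exp _), Real.abs_exp,
        abs_neg, abs_two, abs_of_pos hβ]
      calc |V s| * (2 * β * |y - s| * (Real.exp (-(β / 2) * (y - s) ^ 2) *
            Real.exp (-(β / 2) * (y - s) ^ 2)))
          = |V s| * (2 * β * (|y - s| * Real.exp (-(β / 2) * (y - s) ^ 2)) *
            Real.exp (-(β / 2) * (y - s) ^ 2)) := by ring
        _ ≤ M * (2 * β * gaussMomentBound 1 (β / 2) *
            (Real.exp (β / 2) * Real.exp (-(β / 4) * (s - x) ^ 2))) := by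
            gcongr
            exact abs_primitive_le hu c s
        _ = _ := by ring
    · have h3 : HasDerivAt (fun y : ℝ => y - s) 1 y := (hasDerivAt_id y).sub_const s
      refine ((((h3.pow 2).const_mul (-β)).exp).const_mul (V s)).congr_deriv ?_
      simp only [Pi.pow_apply]
      push_cast
      ring
  have h3 : (fun x => ∫ s, V (x - s) * Real.exp (-β * s ^ 2)) =
      fun x => ∫ s, V s * Real.exp (-β * (x - s) ^ 2) := by
    funext x
    rw [← integral_sub_left_eq_self (fun s => V s * Real.exp (-β * (x - s) ^ 2)) volume x]
    simp only [sub_sub_cancel]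
  have h4 : ∫ s, u (x - s) * Real.exp (-β * s ^ 2) =
      ∫ s, u s * Real.exp (-β * (x - s) ^ 2) := by
    rw [← integral_sub_left_eq_self (fun s => u s * Real.exp (-β * (x - s) ^ 2)) volume x]
    simp only [sub_sub_cancel]
  rw [h3, h4] at h1
  exact h1.unique h2

/-- The normalisation of the weight in `heatExtension_eq_primitive`: it makes the limit exactly `u
x`. -/
theorem integral_two_mul_sq_mul_gaussian :
    ∫ z : ℝ, z * (2 * z * Real.exp (-z ^ 2)) = Real.sqrt Real.pi := by
  have hi0 : Integrable fun z : ℝ => Real.exp (-z ^ 2) := by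
    simpa using integrable_exp_neg_mul_sq one_pos
  have hi1 : Integrable fun z : ℝ => z * Real.exp (-z ^ 2) := by
    simpa using integrable_mul_exp_neg_mul_sq one_pos
  have hi2 : Integrable fun z : ℝ => z ^ 2 * Real.exp (-z ^ 2) := by
    have := integrable_rpow_mul_exp_neg_mul_sq one_pos (s := 2) (by norm_num)
    simpa using this
  have key := integral_mul_deriv_eq_deriv_mul_of_integrable (u := fun z : ℝ => z)
    (v := fun z => -Real.exp (-z ^ 2)) (u' := fun _ => 1) (v' := fun z => 2 * z * Real.exp (-z ^ 2))
    (fun z _ => hasDerivAt_id z) (fun z _ => ?_) ?_ ?_ ?_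
  · rw [key]
    simp only [one_mul, integral_neg, neg_neg]
    simpa using integral_gaussian 1
  · refine (((hasDerivAt_pow 2 z).fun_neg).exp.fun_neg).congr_deriv ?_
    push_cast
    ring
  · refine (hi2.const_mul 2).congr (ae_of_all _ fun z => ?_)
    simp only [Pi.mul_apply]
    ring
  · refine hi0.neg.congr (ae_of_all _ fun z => ?_)
    simp
  · refine hi1.neg.congr (ae_of_all _ fun z => ?_)
    simp

/-- The substitution `s = x + εz`, `ε = √(4tσ)`, exhibits the heat extension as an average of
difference quotients of the primitive of `u`, so differentiability of the primitive at `x` is all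
that the limit `t → 0` requires. -/
theorem heatExtension_eq_primitive {σ : ℝ} (hσ : 0 < σ) (hu : Integrable u)
    (hb : ∀ y, |u y| ≤ b) (x : ℝ) {t : ℝ} (ht : 0 < t) :
    heatExtension σ u x t = 1 / Real.sqrt Real.pi *
      ∫ z, ((Real.sqrt (4 * t * σ))⁻¹ * ∫ r in x..(x + Real.sqrt (4 * t * σ) * z), u r) *
        (2 * z * Real.exp (-z ^ 2)) := by
  set ε := Real.sqrt (4 * t * σ) with hε
  have hε0 : 0 < ε := Real.sqrt_pos.2 (by positivity)
  have hε2 : ε ^ 2 = 4 * t * σ := Real.sq_sqrt (by positivity)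
  have h1 : heatExtension σ u x t =
      1 / (Real.sqrt Real.pi * ε) * ∫ s, u s * Real.exp (-(1 / ε ^ 2) * (x - s) ^ 2) := by
    rw [heatExtension, hε2, hε, ← Real.sqrt_mul Real.pi_pos.le]
    congr 3
    · ring_nf
    · funext s
      congr 2
      ring
  rw [h1, integral_mul_gaussian_eq_primitive hu hb (by positivity) x x]
  have h2 := Measure.integral_comp_mul_left (fun s => (∫ r in x..(x + s), u r) *
    (-2 * (1 / ε ^ 2) * (x - (x + s)) * Real.exp (-(1 / ε ^ 2) * (x - (x + s)) ^ 2))) ε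
  rw [integral_add_left_eq_self (fun s => (∫ r in x..s, u r) *
    (-2 * (1 / ε ^ 2) * (x - s) * Real.exp (-(1 / ε ^ 2) * (x - s) ^ 2))) x,
    abs_of_pos (inv_pos.2 hε0), smul_eq_mul] at h2
  rw [show ∀ I : ℝ, 1 / (Real.sqrt Real.pi * ε) * I = 1 / Real.sqrt Real.pi * (ε⁻¹ * I) by
    intro I; field_simp, ← h2]
  congr 1
  refine integral_congr_ae (ae_of_all _ fun z => ?_)
  simp only
  rw [show -(1 / ε ^ 2) * (x - (x + ε * z)) ^ 2 = -z ^ 2 by field_simp; ring]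
  field_simp
  ring

/-- The heat extension attains its initial value almost everywhere. -/
theorem ae_tendsto_heatExtension {σ : ℝ} (hσ : 0 < σ) (hu : Integrable u) (hb : ∀ y, |u y| ≤ b) :
    ∀ᵐ x, Tendsto (fun t => heatExtension σ u x t) (𝓝[>] 0) (𝓝 (u x)) := by
  filter_upwards [LocallyIntegrable.ae_hasDerivAt_integral hu.locallyIntegrable] with x hx
  have hb0 : 0 ≤ b := (abs_nonneg _).trans (hb 0)
  have hlim : u x = 1 / Real.sqrt Real.pi *
      ∫ z, (u x * z) * (2 * z * Real.exp (-z ^ 2)) := by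
    simp only [mul_assoc (u x)]
    rw [integral_const_mul, integral_two_mul_sq_mul_gaussian]
    have := Real.sqrt_pos.2 Real.pi_pos
    field_simp
  rw [hlim]
  have hev : ∀ᶠ t : ℝ in 𝓝[>] 0, 1 / Real.sqrt Real.pi *
      (∫ z, ((Real.sqrt (4 * t * σ))⁻¹ * ∫ r in x..(x + Real.sqrt (4 * t * σ) * z), u r) *
        (2 * z * Real.exp (-z ^ 2))) = heatExtension σ u x t := by
    filter_upwards [self_mem_nhdsWithin] with t ht
    exact (heatExtension_eq_primitive hσ hu hb x ht).symm
  refine Tendsto.congr' hev (Tendsto.const_mul _ ?_)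
  have hVc := continuous_primitive_of_integrable hu x
  refine tendsto_integral_filter_of_dominated_convergence
    (fun z => b * (2 * (z ^ 2 * Real.exp (-z ^ 2))))
    (Eventually.of_forall fun t => ?_) ?_ ?_ (ae_of_all _ fun z => ?_)
  · have : Continuous fun z : ℝ => ∫ r in x..(x + Real.sqrt (4 * t * σ) * z), u r :=
      hVc.comp (by fun_prop : Continuous fun z : ℝ => x + Real.sqrt (4 * t * σ) * z)
    exact ((continuous_const.mul this).mul (by fun_prop)).aestronglyMeasurable
  · filter_upwards [self_mem_nhdsWithin] with t ht
    refine ae_of_all _ fun z => ?_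
    have ht' : (0 : ℝ) < t := ht
    have hε0 : 0 < Real.sqrt (4 * t * σ) := Real.sqrt_pos.2 (by positivity)
    -- The Lipschitz bound on the primitive supplies a factor `ε` that cancels `ε⁻¹`, making the
    -- majorant independent of `t`.
    have h1 := abs_primitive_sub_le hu hb x (x + Real.sqrt (4 * t * σ) * z) x
    rw [intervalIntegral.integral_same, sub_zero, add_sub_cancel_left, abs_mul,
      abs_of_pos hε0] at h1
    rw [norm_mul, norm_mul, norm_mul, norm_mul, Real.norm_eq_abs, Real.norm_eq_abs,
      Real.norm_eq_abs, Real.norm_eq_abs, Real.norm_eq_abs, Real.abs_exp,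
      abs_of_pos (inv_pos.2 hε0), abs_two]
    calc (Real.sqrt (4 * t * σ))⁻¹ * |∫ r in x..(x + Real.sqrt (4 * t * σ) * z), u r| *
          (2 * |z| * Real.exp (-z ^ 2))
        ≤ (Real.sqrt (4 * t * σ))⁻¹ * (b * (Real.sqrt (4 * t * σ) * |z|)) *
          (2 * |z| * Real.exp (-z ^ 2)) := by gcongr
      _ = b * (2 * (|z| ^ 2 * Real.exp (-z ^ 2))) := by field_simp
      _ = _ := by rw [sq_abs]
  · refine Integrable.const_mul (Integrable.const_mul ?_ 2) b
    have := integrable_rpow_mul_exp_neg_mul_sq one_pos (s := 2) (by norm_num)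
    simpa using this
  · refine Tendsto.mul_const _ ?_
    have h1 : HasDerivAt (fun ε : ℝ => ∫ r in x..(x + ε * z), u r) (u x * z) 0 := by
      have h2 : HasDerivAt (fun ε : ℝ => x + ε * z) z 0 := by
        simpa using ((hasDerivAt_id (0 : ℝ)).mul_const z).const_add x
      have h3 : HasDerivAt (fun y => ∫ r in x..y, u r) (u x) (x + 0 * z) := by simpa using hx x
      exact HasDerivAt.comp (0 : ℝ) h3 h2
    have h4 := h1.tendsto_slope_zero_right
    simp only [zero_add, zero_mul, add_zero, intervalIntegral.integral_same, sub_zero,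
      smul_eq_mul] at h4
    refine h4.comp (tendsto_nhdsWithin_iff.2 ⟨?_, ?_⟩)
    · have : Tendsto (fun t : ℝ => Real.sqrt (4 * t * σ)) (𝓝 0) (𝓝 (Real.sqrt (4 * 0 * σ))) :=
        (by fun_prop : Continuous fun t : ℝ => Real.sqrt (4 * t * σ)).tendsto 0
      simp only [mul_zero, zero_mul, Real.sqrt_zero] at this
      exact this.mono_left nhdsWithin_le_nhds
    · filter_upwards [self_mem_nhdsWithin] with t ht
      have ht' : (0 : ℝ) < t := ht
      exact Real.sqrt_pos.2 (by positivity)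

end InitialValue

/-! ### Monotonicity of `B` and dominated convergence for `B ∘ v` -/

theorem isOpen_openOrthant (n : ℕ) : IsOpen (openOrthant n) := by
  rw [← interior_closedOrthant]
  exact isOpen_interior

theorem openOrthant_subset_closedOrthant (n : ℕ) : openOrthant n ⊆ closedOrthant n :=
  fun _ hy j => (hy j).le

theorem add_smul_mem_openOrthant {n : ℕ} {y v : Fin n → ℝ} (hy : y ∈ openOrthant n)
    (hv : ∀ j, 0 ≤ v j) {s : ℝ} (hs : 0 ≤ s) : y + s • v ∈ openOrthant n := fun j => by
  have := mul_nonneg hs (hv j)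
  have := hy j
  simp only [Pi.add_apply, Pi.smul_apply, smul_eq_mul]
  linarith

theorem transpose_mul_mul_colMatrix_apply {k n : ℕ} (a : Fin n → EuclideanSpace ℝ (Fin k))
    (C : Matrix (Fin k) (Fin k) ℝ) (i j : Fin n) :
    ((colMatrix a)ᵀ * C * colMatrix a) i j = ∑ p, ∑ q, C p q * a i p * a j q := by
  simp only [Matrix.mul_apply, colMatrix, Matrix.transpose_apply, Matrix.of_apply,
    Finset.sum_mul]
  rw [Finset.sum_comm]
  exact Finset.sum_congr rfl fun p _ => Finset.sum_congr rfl fun q _ => by ring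

theorem quadForm_eq_sum {k : ℕ} (C : Matrix (Fin k) (Fin k) ℝ) (v : EuclideanSpace ℝ (Fin k)) :
    quadForm C v = ∑ p, ∑ q, C p q * v p * v q := by
  unfold quadForm
  refine Finset.sum_congr rfl fun p _ => ?_
  rw [Finset.sum_mul]
  exact Finset.sum_congr rfl fun q _ => by ring

namespace IsBrascampLiebBellman

variable {k n : ℕ} {a : Fin n → EuclideanSpace ℝ (Fin k)} {C : Matrix (Fin k) (Fin k) ℝ}
  {B : (Fin n → ℝ) → ℝ}

theorem hasFDerivAt (hB : IsBrascampLiebBellman a C B) {y : Fin n → ℝ}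
    (hy : y ∈ openOrthant n) : HasFDerivAt B (fderiv ℝ B y) y :=
  ((hB.contDiffOn.contDiffAt ((isOpen_openOrthant n).mem_nhds hy)).differentiableAt
    (by norm_num)).hasFDerivAt

theorem contDiffOn_fderiv (hB : IsBrascampLiebBellman a C B) :
    ContDiffOn ℝ 1 (fderiv ℝ B) (openOrthant n) :=
  hB.contDiffOn.fderiv_of_isOpen (isOpen_openOrthant n) (by norm_num)

theorem hasFDerivAt_fderiv (hB : IsBrascampLiebBellman a C B) {y : Fin n → ℝ}
    (hy : y ∈ openOrthant n) : HasFDerivAt (fderiv ℝ B) (fderiv ℝ (fderiv ℝ B) y) y :=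
  ((hB.contDiffOn_fderiv.contDiffAt ((isOpen_openOrthant n).mem_nhds hy)).differentiableAt
    (by norm_num)).hasFDerivAt

theorem continuousAt_fderiv (hB : IsBrascampLiebBellman a C B) {y : Fin n → ℝ}
    (hy : y ∈ openOrthant n) : ContinuousAt (fderiv ℝ B) y :=
  (hB.hasFDerivAt_fderiv hy).continuousAt

theorem continuousAt_fderiv_fderiv (hB : IsBrascampLiebBellman a C B) {y : Fin n → ℝ}
    (hy : y ∈ openOrthant n) : ContinuousAt (fderiv ℝ (fderiv ℝ B)) y :=
  (hB.contDiffOn_fderiv.continuousOn_fderiv_of_isOpen (isOpen_openOrthant n)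
    le_rfl).continuousAt ((isOpen_openOrthant n).mem_nhds hy)

/-- The diagonal entries of `A*CA` are the positive numbers `⟨C a_j, a_j⟩`, so the diagonal of L3
fixes the sign. -/
theorem hessian_diag_nonpos (hB : IsBrascampLiebBellman a C B) {y : Fin n → ℝ}
    (hy : y ∈ openOrthant n) (j : Fin n) :
    fderiv ℝ (fderiv ℝ B) y (Pi.single j 1) (Pi.single j 1) ≤ 0 := by
  have h := (hB.concave y hy).diag_nonneg (i := j)
  rw [Matrix.neg_apply, concavityMatrix, Matrix.hadamard_apply,
    transpose_mul_mul_colMatrix_apply, ← quadForm_eq_sum] at h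
  have h2 := hB.quadForm_pos j
  simp only [hessian, Matrix.of_apply] at h
  by_contra! hc
  have := mul_pos h2 hc
  linarith

theorem hasDerivAt_add_smul (hB : IsBrascampLiebBellman a C B) {y v : Fin n → ℝ} {s : ℝ}
    (hy : y + s • v ∈ openOrthant n) :
    HasDerivAt (fun s : ℝ => B (y + s • v)) (fderiv ℝ B (y + s • v) v) s := by
  have h1 : HasDerivAt (fun s : ℝ => y + s • v) v s := by
    simpa using ((hasDerivAt_id s).smul_const v).const_add y
  exact (hB.hasFDerivAt hy).comp_hasDerivAt s h1

theorem hasDerivAt_fderiv_add_smul (hB : IsBrascampLiebBellman a C B) {y v : Fin n → ℝ} {s : ℝ}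
    (hy : y + s • v ∈ openOrthant n) (w : Fin n → ℝ) :
    HasDerivAt (fun s : ℝ => fderiv ℝ B (y + s • v) w)
      (fderiv ℝ (fderiv ℝ B) (y + s • v) v w) s := by
  have h1 : HasDerivAt (fun s : ℝ => y + s • v) v s := by
    simpa using ((hasDerivAt_id s).smul_const v).const_add y
  have h2 := (hB.hasFDerivAt_fderiv hy).comp_hasDerivAt s h1
  exact ((ContinuousLinearMap.apply ℝ ℝ w).hasFDerivAt.comp_hasDerivAt s h2)

/-- Along the ray `y + s e_j` the function `B` is concave and nonnegative; a negative initial slope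
would drive it below zero. -/
theorem fderiv_single_nonneg (hB : IsBrascampLiebBellman a C B) {y : Fin n → ℝ}
    (hy : y ∈ openOrthant n) (j : Fin n) : 0 ≤ fderiv ℝ B y (Pi.single j 1) := by
  by_contra! hneg
  have he0 : ∀ i, 0 ≤ (Pi.single j 1 : Fin n → ℝ) i := fun i => by
    by_cases h : i = j
    · subst h; simp
    · simp [h]
  have hH : ∀ y ∈ openOrthant n,
      fderiv ℝ (fderiv ℝ B) y (Pi.single j 1) (Pi.single j 1) ≤ 0 :=
    fun y hy => hB.hessian_diag_nonpos hy j
  generalize (Pi.single j 1 : Fin n → ℝ) = e at *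
  have hmem : ∀ s : ℝ, 0 ≤ s → y + s • e ∈ openOrthant n :=
    fun s hs => add_smul_mem_openOrthant hy he0 hs
  have h1 : ∀ s : ℝ, 0 ≤ s → HasDerivAt (fun s : ℝ => B (y + s • e))
      (fderiv ℝ B (y + s • e) e) s := fun s hs => hB.hasDerivAt_add_smul (hmem s hs)
  have h2 : ∀ s : ℝ, 0 ≤ s → HasDerivAt (fun s : ℝ => fderiv ℝ B (y + s • e) e)
      (fderiv ℝ (fderiv ℝ B) (y + s • e) e e) s := fun s hs =>
    hB.hasDerivAt_fderiv_add_smul (hmem s hs) e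
  have hanti : AntitoneOn (fun s : ℝ => fderiv ℝ B (y + s • e) e) (Set.Ici 0) := by
    refine antitoneOn_of_deriv_nonpos (convex_Ici 0)
      (fun s hs => (h2 s hs).continuousAt.continuousWithinAt) ?_ ?_
    · rw [interior_Ici]
      exact fun s hs => (h2 s (le_of_lt hs)).differentiableAt.differentiableWithinAt
    · rw [interior_Ici]
      intro s hs
      rw [(h2 s (le_of_lt hs)).deriv]
      exact hH _ (hmem s (le_of_lt hs))
  have hle : ∀ s : ℝ, 0 ≤ s → B (y + s • e) - B (y + (0 : ℝ) • e) ≤ fderiv ℝ B y e * (s - 0) := by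
    intro s hs
    refine (convex_Ici (0 : ℝ)).image_sub_le_mul_sub_of_deriv_le
      (f := fun s : ℝ => B (y + s • e))
      (fun s hs => (h1 s hs).continuousAt.continuousWithinAt) ?_ ?_ 0 Set.self_mem_Ici s hs hs
    · rw [interior_Ici]
      exact fun s hs => (h1 s (le_of_lt hs)).differentiableAt.differentiableWithinAt
    · rw [interior_Ici]
      intro s hs
      rw [(h1 s (le_of_lt hs)).deriv]
      simpa using hanti Set.self_mem_Ici (le_of_lt hs : (0 : ℝ) ≤ s) (le_of_lt hs)
  have hBy := hB.nonneg y (openOrthant_subset_closedOrthant n hy)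
  -- The parameter at which the tangent line at `y` has fallen to `-1`.
  set s₀ : ℝ := (B y + 1) / -fderiv ℝ B y e with hs₀
  have hs₀0 : 0 ≤ s₀ := div_nonneg (by linarith) (by linarith)
  have h3 := hle s₀ hs₀0
  have h4 := hB.nonneg _ (openOrthant_subset_closedOrthant n (hmem s₀ hs₀0))
  have h5 : fderiv ℝ B y e * s₀ = -(B y + 1) := by
    have := hneg.ne
    rw [hs₀]
    field_simp
  rw [zero_smul, add_zero, sub_zero, h5] at h3
  linarith

theorem le_of_le_of_mem_openOrthant (hB : IsBrascampLiebBellman a C B) {y z : Fin n → ℝ}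
    (hy : y ∈ openOrthant n) (hyz : ∀ j, y j ≤ z j) : B y ≤ B z := by
  have hv : ∀ j, 0 ≤ (z - y) j := fun j => sub_nonneg.2 (hyz j)
  have hd : ∀ s : ℝ, 0 ≤ s → HasDerivAt (fun s : ℝ => B (y + s • (z - y)))
      (fderiv ℝ B (y + s • (z - y)) (z - y)) s := fun s hs =>
    hB.hasDerivAt_add_smul (add_smul_mem_openOrthant hy hv hs)
  have hmono : MonotoneOn (fun s : ℝ => B (y + s • (z - y))) (Set.Ici 0) := by
    refine monotoneOn_of_deriv_nonneg (convex_Ici 0)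
      (fun s hs => (hd s hs).continuousAt.continuousWithinAt) ?_ ?_
    · rw [interior_Ici]
      exact fun s hs => (hd s (le_of_lt hs)).differentiableAt.differentiableWithinAt
    · rw [interior_Ici]
      intro s hs
      rw [(hd s (le_of_lt hs)).deriv]
      have hsum : z - y = ∑ j, (z - y) j • (Pi.single j (1 : ℝ) : Fin n → ℝ) := by
        simpa using pi_eq_sum_univ' (z - y)
      generalize hL : fderiv ℝ B (y + s • (z - y)) = L
      rw [hsum, map_sum]
      refine Finset.sum_nonneg fun j _ => ?_
      rw [map_smul, smul_eq_mul, ← hL]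
      exact mul_nonneg (hv j)
        (hB.fderiv_single_nonneg (add_smul_mem_openOrthant hy hv (le_of_lt hs)) j)
  simpa using hmono Set.self_mem_Ici (zero_le_one : (0 : ℝ) ≤ 1) zero_le_one

theorem mono (hB : IsBrascampLiebBellman a C B) {y z : Fin n → ℝ}
    (hy : y ∈ closedOrthant n) (hyz : ∀ j, y j ≤ z j) : B y ≤ B z := by
  -- Boundary points are reached by adding `ε` to every coordinate and using continuity on the
  -- closed orthant.
  have hlim : ∀ w ∈ closedOrthant n, Tendsto (fun ε : ℝ => B fun j => w j + ε) (𝓝[>] 0)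
      (𝓝 (B w)) := fun w hw => by
    refine (hB.continuousOn w hw).tendsto.comp (tendsto_nhdsWithin_iff.2 ⟨?_, ?_⟩)
    · have : Tendsto (fun (ε : ℝ) (j : Fin n) => w j + ε) (𝓝 0) (𝓝 fun j => w j + 0) :=
        (by fun_prop : Continuous fun (ε : ℝ) (j : Fin n) => w j + ε).tendsto 0
      simp only [add_zero] at this
      exact this.mono_left nhdsWithin_le_nhds
    · filter_upwards [self_mem_nhdsWithin] with ε hε j
      exact add_nonneg (hw j) (le_of_lt hε)
  refine le_of_tendsto_of_tendsto (hlim y hy) (hlim z fun j => (hy j).trans (hyz j)) ?_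
  filter_upwards [self_mem_nhdsWithin] with ε hε
  exact hB.le_of_le_of_mem_openOrthant (fun j => add_pos_of_nonneg_of_pos (hy j) hε)
    fun j => by linarith [hyz j]

theorem aestronglyMeasurable_comp (hB : IsBrascampLiebBellman a C B) {X : Type*}
    [MeasurableSpace X] {μ : Measure X} {v : X → Fin n → ℝ} (hv : ∀ j, AEMeasurable (v · j) μ)
    (h0 : ∀ x j, 0 ≤ v x j) : AEStronglyMeasurable (fun x => B (v x)) μ := by
  -- Nothing is known of `B` off the closed orthant; truncating the coordinates at 0 gives a
  -- globally continuous function with the same values there.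
  have hc : Continuous fun y : Fin n → ℝ => B fun j => max (y j) 0 :=
    hB.continuousOn.comp_continuous (by fun_prop) fun y j => le_max_right _ _
  have h := hc.measurable.comp_aemeasurable (aemeasurable_pi_lambda v hv)
  have he : (fun x => B (v x)) = (fun y : Fin n → ℝ => B fun j => max (y j) 0) ∘ v := by
    funext x
    simp only [Function.comp, max_eq_left (h0 x _)]
  rw [he]
  exact h.aestronglyMeasurable

/-- Homogeneity takes out `b ^ k`, and dilating by `√δ` reduces to L5. -/
theorem integrable_gaussian (hB : IsBrascampLiebBellman a C B) {b δ : ℝ} (hb : 0 < b)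
    (hδ : 0 < δ) : Integrable fun x : EuclideanSpace ℝ (Fin k) =>
      B fun j => b * Real.exp (-δ * inner ℝ (a j) x ^ 2) := by
  have h1 := (hB.integrable_exp.comp_smul (Real.sqrt_pos.2 hδ).ne').const_mul (b ^ k)
  refine h1.congr (ae_of_all _ fun x => ?_)
  simp only
  rw [← hB.homogeneous b hb.le _ fun j => (Real.exp_pos _).le]
  congr 1
  funext j
  simp only [Pi.smul_apply, smul_eq_mul, inner_smul_right, mul_pow, Real.sq_sqrt hδ.le, neg_mul]

theorem norm_comp_le (hB : IsBrascampLiebBellman a C B) {y z : Fin n → ℝ}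
    (h0 : ∀ j, 0 ≤ y j) (hyz : ∀ j, y j ≤ z j) : ‖B y‖ ≤ B z := by
  rw [Real.norm_of_nonneg (hB.nonneg _ h0)]
  exact hB.mono h0 hyz

theorem integrable_comp (hB : IsBrascampLiebBellman a C B) {b δ : ℝ} (hb : 0 < b)
    (hδ : 0 < δ) {v : EuclideanSpace ℝ (Fin k) → Fin n → ℝ}
    (hv : ∀ j, AEMeasurable (v · j)) (h0 : ∀ x j, 0 ≤ v x j)
    (hle : ∀ x j, v x j ≤ b * Real.exp (-δ * inner ℝ (a j) x ^ 2)) :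
    Integrable fun x => B (v x) :=
  (hB.integrable_gaussian hb hδ).mono' (hB.aestronglyMeasurable_comp hv h0)
    (ae_of_all _ fun x => hB.norm_comp_le (h0 x) (hle x))

/-- The common form of the limits at `t → 0` and `t → ∞`: by monotonicity, a Gaussian bound on the
arguments of `B` is a domination of the integrands. -/
theorem tendsto_integral_comp (hB : IsBrascampLiebBellman a C B) {ι : Type*} {l : Filter ι}
    [l.IsCountablyGenerated] {b δ : ℝ} (hb : 0 < b)
    (hδ : 0 < δ) {v : ι → EuclideanSpace ℝ (Fin k) → Fin n → ℝ}
    {w : EuclideanSpace ℝ (Fin k) → Fin n → ℝ}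
    (hv : ∀ᶠ i in l, (∀ j, AEMeasurable (v i · j)) ∧ ∀ x j, 0 ≤ v i x j ∧
      v i x j ≤ b * Real.exp (-δ * inner ℝ (a j) x ^ 2))
    (hw : ∀ x j, 0 ≤ w x j)
    (hlim : ∀ᵐ x, ∀ j, Tendsto (fun i => v i x j) l (𝓝 (w x j))) :
    Tendsto (fun i => ∫ x, B (v i x)) l (𝓝 (∫ x, B (w x))) := by
  refine tendsto_integral_filter_of_dominated_convergence
    (fun x => B fun j => b * Real.exp (-δ * inner ℝ (a j) x ^ 2)) ?_ ?_
    (hB.integrable_gaussian hb hδ) ?_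
  · filter_upwards [hv] with i hi
    exact hB.aestronglyMeasurable_comp hi.1 fun x j => (hi.2 x j).1
  · filter_upwards [hv] with i hi
    exact ae_of_all _ fun x => hB.norm_comp_le (fun j => (hi.2 x j).1) fun j => (hi.2 x j).2
  · filter_upwards [hlim] with x hx
    refine (hB.continuousOn (w x) (hw x)).tendsto.comp (tendsto_nhdsWithin_iff.2
      ⟨tendsto_pi_nhds.2 hx, ?_⟩)
    filter_upwards [hv] with i hi j
    exact (hi.2 x j).1

end IsBrascampLiebBellman

/-- Gaussian bounds for finitely many functions can be taken with common constants. -/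
theorem exists_common_gaussian_bound {n : ℕ} {P : Fin n → ℝ → ℝ → Prop}
    (h : ∀ j, ∃ b > 0, ∃ δ > 0, P j b δ)
    (hmono : ∀ j b b' δ δ', b ≤ b' → δ' ≤ δ → P j b δ → P j b' δ') :
    ∃ b > 0, ∃ δ > 0, ∀ j, P j b δ := by
  choose b hb δ hδ hP using h
  -- Working in the subtype of positive reals keeps the common constants positive, even for an empty
  -- family.
  obtain ⟨M, hM⟩ := Finite.exists_le fun j => (⟨b j, hb j⟩ : Set.Ioi (0 : ℝ))
  obtain ⟨m, hm⟩ := Finite.exists_ge fun j => (⟨δ j, hδ j⟩ : Set.Ioi (0 : ℝ))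
  exact ⟨M, M.2, m, m.2, fun j => hmono j _ _ _ _ (hM j) (hm j) (hP j)⟩

theorem mul_exp_le_mul_exp {b b' δ δ' : ℝ} (hb : 0 < b') (hbb : b ≤ b') (hδ : δ' ≤ δ) (y : ℝ) :
    b * Real.exp (-δ * y ^ 2) ≤ b' * Real.exp (-δ' * y ^ 2) := by
  have : -δ * y ^ 2 ≤ -δ' * y ^ 2 := by nlinarith [sq_nonneg y]
  gcongr

/-! ### Constant-coefficient operators and test functions -/

/-- The second-order operator `∑ C_{pq} ∂_p ∂_q` with constant coefficients. -/
noncomputable def constCoeffOperator {k : ℕ} (C : Matrix (Fin k) (Fin k) ℝ)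
    (f : EuclideanSpace ℝ (Fin k) → ℝ) (x : EuclideanSpace ℝ (Fin k)) : ℝ :=
  ∑ p, ∑ q, C p q * fderiv ℝ (fun y => fderiv ℝ f y (EuclideanSpace.single q 1)) x
    (EuclideanSpace.single p 1)

section TestFunctions

variable {E : Type*} [NormedAddCommGroup E] [NormedSpace ℝ E]

theorem ContDiff.fderiv_apply_const {f : E → ℝ} {m l : WithTop ℕ∞} (hf : ContDiff ℝ l f)
    (h : m + 1 ≤ l) (v : E) : ContDiff ℝ m fun x => fderiv ℝ f x v :=
  (hf.fderiv_right h).clm_apply contDiff_const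

variable [MeasurableSpace E] [BorelSpace E] [FiniteDimensional ℝ E] {μ : Measure E}
  [μ.IsAddHaarMeasure]

theorem integral_mul_fderiv_eq_neg_of_hasCompactSupport {φ f : E → ℝ} (hφ : ContDiff ℝ 1 φ)
    (hc : HasCompactSupport φ) (hf : ContDiff ℝ 1 f) (v : E) :
    ∫ x, φ x * fderiv ℝ f x v ∂μ = -∫ x, fderiv ℝ φ x v * f x ∂μ := by
  have hφ' : Continuous fun x => fderiv ℝ φ x v :=
    (hφ.fderiv_apply_const (m := 0) (by norm_num) v).continuous
  have hf' : Continuous fun x => fderiv ℝ f x v :=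
    (hf.fderiv_apply_const (m := 0) (by norm_num) v).continuous
  exact integral_mul_fderiv_eq_neg_fderiv_mul_of_integrable
    ((hφ'.mul hf.continuous).integrable_of_hasCompactSupport (hc.fderiv_apply ℝ v).mul_right)
    ((hφ.continuous.mul hf').integrable_of_hasCompactSupport hc.mul_right)
    ((hφ.continuous.mul hf.continuous).integrable_of_hasCompactSupport hc.mul_right)
    (fun x _ => (hφ.differentiable (by norm_num)) x)
    (fun x _ => (hf.differentiable (by norm_num)) x)

theorem integral_mul_fderiv_fderiv_of_hasCompactSupport {φ f : E → ℝ} (hφ : ContDiff ℝ 2 φ)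
    (hc : HasCompactSupport φ) (hf : ContDiff ℝ 2 f) (v w : E) :
    ∫ x, φ x * fderiv ℝ (fun y => fderiv ℝ f y w) x v ∂μ =
      ∫ x, fderiv ℝ (fun y => fderiv ℝ φ y v) x w * f x ∂μ := by
  rw [integral_mul_fderiv_eq_neg_of_hasCompactSupport (hφ.of_le (by norm_num)) hc
    (hf.fderiv_apply_const (by norm_num) w),
    integral_mul_fderiv_eq_neg_of_hasCompactSupport (hφ.fderiv_apply_const (by norm_num) v)
    (hc.fderiv_apply ℝ v) (hf.of_le (by norm_num)), neg_neg]

end TestFunctions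

section Operator

variable {k : ℕ} {C : Matrix (Fin k) (Fin k) ℝ} {φ f : EuclideanSpace ℝ (Fin k) → ℝ}

theorem continuous_fderiv_fderiv_apply (hf : ContDiff ℝ 2 f) (v w : EuclideanSpace ℝ (Fin k)) :
    Continuous fun x => fderiv ℝ (fun y => fderiv ℝ f y v) x w :=
  ((hf.fderiv_apply_const (m := 1) (by norm_num) v).fderiv_apply_const (m := 0)
    (by norm_num) w).continuous

theorem continuous_constCoeffOperator (C : Matrix (Fin k) (Fin k) ℝ) (hf : ContDiff ℝ 2 f) :
    Continuous (constCoeffOperator C f) :=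
  continuous_finsetSum _ fun _ _ => continuous_finsetSum _ fun _ _ =>
    continuous_const.mul (continuous_fderiv_fderiv_apply hf _ _)

theorem constCoeffOperator_eq_zero_of_notMem_tsupport (C : Matrix (Fin k) (Fin k) ℝ)
    {x : EuclideanSpace ℝ (Fin k)} (hx : x ∉ tsupport φ) : constCoeffOperator C φ x = 0 := by
  refine Finset.sum_eq_zero fun p _ => Finset.sum_eq_zero fun q _ => ?_
  have h1 : x ∉ tsupport fun y => fderiv ℝ φ y (EuclideanSpace.single q 1) :=
    fun h => hx (tsupport_fderiv_apply_subset ℝ _ h)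
  have h2 : x ∉ tsupport fun x => fderiv ℝ (fun y => fderiv ℝ φ y (EuclideanSpace.single q 1)) x
      (EuclideanSpace.single p 1) := fun h => h1 (tsupport_fderiv_apply_subset ℝ _ h)
  have h3 := image_eq_zero_of_notMem_tsupport h2
  exact mul_eq_zero_of_right _ h3

theorem hasCompactSupport_constCoeffOperator (C : Matrix (Fin k) (Fin k) ℝ)
    (hc : HasCompactSupport φ) : HasCompactSupport (constCoeffOperator C φ) :=
  HasCompactSupport.intro hc fun _ hx => constCoeffOperator_eq_zero_of_notMem_tsupport C hx

/-- The operator `∑ C_{pq} ∂_p ∂_q` is symmetric on test functions. -/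
theorem integral_mul_constCoeffOperator (hC : C.IsSymm) (hφ : ContDiff ℝ 2 φ)
    (hc : HasCompactSupport φ) (hf : ContDiff ℝ 2 f) :
    ∫ x, φ x * constCoeffOperator C f x = ∫ x, constCoeffOperator C φ x * f x := by
  simp only [constCoeffOperator, Finset.mul_sum, Finset.sum_mul]
  have h1 : ∀ p q : Fin k, Integrable fun x => φ x * (C p q *
      fderiv ℝ (fun y => fderiv ℝ f y (EuclideanSpace.single q 1)) x
        (EuclideanSpace.single p 1)) := fun p q =>
    (hφ.continuous.mul (continuous_const.mul
      (continuous_fderiv_fderiv_apply hf _ _))).integrable_of_hasCompactSupport hc.mul_right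
  have h2 : ∀ p q : Fin k, Integrable fun x => C p q *
      fderiv ℝ (fun y => fderiv ℝ φ y (EuclideanSpace.single q 1)) x
        (EuclideanSpace.single p 1) * f x := fun p q => by
    refine ((continuous_const.mul (continuous_fderiv_fderiv_apply hφ _ _)).mul
      hf.continuous).integrable_of_hasCompactSupport ?_
    exact (((hc.fderiv_apply ℝ _).fderiv_apply ℝ _).mul_left).mul_right
  rw [integral_finsetSum _ fun p _ => integrable_finsetSum _ fun q _ => h1 p q,
    integral_finsetSum _ fun p _ => integrable_finsetSum _ fun q _ => h2 p q]
  simp_rw [integral_finsetSum _ fun q _ => h1 _ q, integral_finsetSum _ fun q _ => h2 _ q]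
  -- The two integrations by parts interchange the directions; the symmetry of `C` compensates after
  -- relabelling.
  rw [Finset.sum_comm]
  refine Finset.sum_congr rfl fun q _ => Finset.sum_congr rfl fun p _ => ?_
  simp only [mul_left_comm (φ _), mul_assoc]
  rw [integral_const_mul, integral_const_mul,
    integral_mul_fderiv_fderiv_of_hasCompactSupport hφ hc hf, hC.apply q p]

theorem constCoeffOperator_comp_smul (C : Matrix (Fin k) (Fin k) ℝ) (hφ : ContDiff ℝ 2 φ) (c : ℝ)
    (x : EuclideanSpace ℝ (Fin k)) :
    constCoeffOperator C (fun y => φ (c • y)) x = c ^ 2 * constCoeffOperator C φ (c • x) := by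
  simp only [constCoeffOperator, Finset.mul_sum]
  refine Finset.sum_congr rfl fun p _ => Finset.sum_congr rfl fun q _ => ?_
  have h1 : (fun y => fderiv ℝ (fun y => φ (c • y)) y (EuclideanSpace.single q 1)) =
      fun y => c * (fun z => fderiv ℝ φ z (EuclideanSpace.single q 1)) (c • y) := by
    funext y
    rw [fderiv_comp_smul]
    rfl
  have h2 : Differentiable ℝ fun z => fderiv ℝ φ z (EuclideanSpace.single q 1) :=
    (hφ.fderiv_apply_const (m := 1) (by norm_num) _).differentiable (by norm_num)
  have h3 : DifferentiableAt ℝ (fun y => (fun z => fderiv ℝ φ z (EuclideanSpace.single q 1))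
      (c • y)) x := (h2 (c • x)).comp x (differentiableAt_id.const_smul c)
  rw [h1, fderiv_const_mul h3,
    fderiv_comp_smul (f := fun z => fderiv ℝ φ z (EuclideanSpace.single q 1))]
  simp only [smul_apply, smul_eq_mul]
  ring

end Operator

/-! ### The forced heat equation in weak form -/

theorem continuousOn_integral_mul_of_hasCompactSupport {k : ℕ}
    {F : ℝ → EuclideanSpace ℝ (Fin k) → ℝ} {φ : EuclideanSpace ℝ (Fin k) → ℝ} {s : Set ℝ}
    (hF : ContinuousOn (Function.uncurry F) (s ×ˢ Set.univ)) (hφ : Continuous φ)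
    (hc : HasCompactSupport φ) : ContinuousOn (fun t => ∫ x, φ x * F t x) s := by
  refine continuousOn_integral_of_compact_support hc
    (f := fun t x => φ x * F t x) ?_ fun t x _ hx => ?_
  · exact (hφ.comp continuous_snd).continuousOn.mul hF
  · rw [image_eq_zero_of_notMem_tsupport hx, zero_mul]

theorem intervalIntegrable_integral_mul_of_hasCompactSupport {k : ℕ}
    {F : ℝ → EuclideanSpace ℝ (Fin k) → ℝ} {φ : EuclideanSpace ℝ (Fin k) → ℝ} {t₁ t₂ : ℝ}
    (hF : ContinuousOn (Function.uncurry F) (Set.Ioi 0 ×ˢ Set.univ)) (hφ : Continuous φ)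
    (hc : HasCompactSupport φ) (h1 : 0 < t₁) (h12 : t₁ ≤ t₂) :
    IntervalIntegrable (fun t => ∫ x, φ x * F t x) volume t₁ t₂ := by
  refine ((continuousOn_integral_mul_of_hasCompactSupport hF hφ hc).mono ?_).intervalIntegrable
  rw [Set.uIcc_of_le h12]
  exact fun t ht => h1.trans_le ht.1

/-- `f` solves `∂_t f = ∑ C_{pq} ∂_p ∂_q f + Q` for positive times, with `g = ∂_t f`. -/
structure SolvesForcedHeat {k : ℕ} (C : Matrix (Fin k) (Fin k) ℝ)
    (f g Q : ℝ → EuclideanSpace ℝ (Fin k) → ℝ) : Prop where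
  hasDerivAt : ∀ x t, 0 < t → HasDerivAt (fun t => f t x) (g t x) t
  contDiff : ∀ t, 0 < t → ContDiff ℝ 2 (f t)
  continuousOn_deriv : ContinuousOn (Function.uncurry g) (Set.Ioi 0 ×ˢ Set.univ)
  continuousOn_source : ContinuousOn (Function.uncurry Q) (Set.Ioi 0 ×ˢ Set.univ)
  eq_add : ∀ x t, 0 < t → g t x = constCoeffOperator C (f t) x + Q t x

namespace SolvesForcedHeat

variable {k : ℕ} {C : Matrix (Fin k) (Fin k) ℝ} {f g Q : ℝ → EuclideanSpace ℝ (Fin k) → ℝ}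
  {φ : EuclideanSpace ℝ (Fin k) → ℝ} {t₁ t₂ : ℝ}

theorem continuous_source (h : SolvesForcedHeat C f g Q) {t : ℝ} (ht : 0 < t) :
    Continuous (Q t) :=
  h.continuousOn_source.comp_continuous (f := fun x => (t, x)) (by fun_prop) fun _ => ⟨ht, trivial⟩

theorem continuous_deriv (h : SolvesForcedHeat C f g Q) {t : ℝ} (ht : 0 < t) :
    Continuous (g t) :=
  h.continuousOn_deriv.comp_continuous (f := fun x => (t, x)) (by fun_prop) fun _ => ⟨ht, trivial⟩

/-- For Fubini: the integrand is continuous on the compact set `[t₁, t₂] × tsupport φ` and zero off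
it. -/
theorem integrable_mul_deriv (h : SolvesForcedHeat C f g Q) (hφ : Continuous φ)
    (hc : HasCompactSupport φ) (h1 : 0 < t₁) (h12 : t₁ ≤ t₂) :
    Integrable (Function.uncurry fun t x => φ x * g t x)
      ((volume.restrict (Set.uIoc t₁ t₂)).prod volume) := by
  rw [← Measure.restrict_univ (μ := (volume : Measure (EuclideanSpace ℝ (Fin k)))),
    Measure.prod_restrict, Set.uIoc_of_le h12]
  have hK : IntegrableOn (Function.uncurry fun t x => φ x * g t x)
      (Set.Icc t₁ t₂ ×ˢ tsupport φ) (volume.prod volume) := by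
    refine ContinuousOn.integrableOn_compact (isCompact_Icc.prod hc) ?_
    exact (hφ.comp continuous_snd).continuousOn.mul (h.continuousOn_deriv.mono
      fun p hp => ⟨h1.trans_le hp.1.1, trivial⟩)
  have hK' : IntegrableOn (Function.uncurry fun t x => φ x * g t x)
      (Set.Icc t₁ t₂ ×ˢ Set.univ) (volume.prod volume) := by
    refine hK.of_forall_sdiff_eq_zero (measurableSet_Icc.prod MeasurableSet.univ) fun p hp => ?_
    have : p.2 ∉ tsupport φ := fun hx => hp.2 ⟨hp.1.1, hx⟩
    simp [Function.uncurry, image_eq_zero_of_notMem_tsupport this]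
  exact hK'.mono_set (Set.prod_mono Set.Ioc_subset_Icc_self le_rfl)

/-- The equation tested against `φ` and integrated over `[t₁, t₂]`. -/
theorem integral_mul_sub_integral_mul (h : SolvesForcedHeat C f g Q) (hC : C.IsSymm)
    (hφ : ContDiff ℝ 2 φ) (hc : HasCompactSupport φ) (h1 : 0 < t₁) (h12 : t₁ ≤ t₂) :
    ((∫ x, φ x * f t₂ x) - ∫ x, φ x * f t₁ x) - ∫ t in t₁..t₂, ∫ x, φ x * Q t x =
      ∫ t in t₁..t₂, ∫ x, constCoeffOperator C φ x * f t x := by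
  have hi : ∀ t, 0 < t → Integrable fun x => φ x * f t x := fun t ht =>
    (hφ.continuous.mul (h.contDiff t ht).continuous).integrable_of_hasCompactSupport hc.mul_right
  rw [← integral_sub (hi t₂ (h1.trans_le h12)) (hi t₁ h1)]
  have hpos : ∀ t ∈ Set.uIcc t₁ t₂, 0 < t := fun t ht => by
    rw [Set.uIcc_of_le h12] at ht
    exact h1.trans_le ht.1
  have hftc : ∀ x, φ x * f t₂ x - φ x * f t₁ x = ∫ t in t₁..t₂, φ x * g t x := fun x => by
    rw [intervalIntegral.integral_const_mul, intervalIntegral.integral_eq_sub_of_hasDerivAt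
      (fun t ht => h.hasDerivAt x t (hpos t ht)), mul_sub]
    refine ContinuousOn.intervalIntegrable ?_
    exact h.continuousOn_deriv.comp (f := fun t => (t, x)) (by fun_prop)
      fun t ht => ⟨hpos t ht, trivial⟩
  simp_rw [hftc]
  rw [← intervalIntegral_integral_swap (h.integrable_mul_deriv hφ.continuous hc h1 h12),
    ← intervalIntegral.integral_sub
      (intervalIntegrable_integral_mul_of_hasCompactSupport h.continuousOn_deriv hφ.continuous
        hc h1 h12)
      (intervalIntegrable_integral_mul_of_hasCompactSupport h.continuousOn_source hφ.continuous
        hc h1 h12)]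
  refine intervalIntegral.integral_congr fun t ht => ?_
  have ht0 := hpos t ht
  rw [← integral_mul_constCoeffOperator hC hφ hc (h.contDiff t ht0), ← integral_sub]
  · refine integral_congr_ae (ae_of_all _ fun x => ?_)
    simp only
    rw [h.eq_add x t ht0]
    ring
  · exact (hφ.continuous.mul (h.continuous_deriv ht0)).integrable_of_hasCompactSupport
      hc.mul_right
  · exact (hφ.continuous.mul (h.continuous_source ht0)).integrable_of_hasCompactSupport
      hc.mul_right

end SolvesForcedHeat

/-! ### Cutoff functions -/

/-- A smooth bump function on `ℝᵏ`, equal to `1` on the unit ball. -/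
noncomputable def unitBump (k : ℕ) : ContDiffBump (0 : EuclideanSpace ℝ (Fin k)) :=
  ⟨1, 2, one_pos, one_lt_two⟩

/-- Smooth cutoff functions on `ℝᵏ`, equal to `1` on the ball of radius `m + 1`. -/
noncomputable def cutoff (k m : ℕ) (x : EuclideanSpace ℝ (Fin k)) : ℝ :=
  unitBump k (((m : ℝ) + 1)⁻¹ • x)

section Cutoff

variable (k m : ℕ)

theorem contDiff_cutoff : ContDiff ℝ 2 (cutoff k m) :=
  (unitBump k).contDiff.comp (contDiff_id.const_smul _)

theorem hasCompactSupport_cutoff : HasCompactSupport (cutoff k m) :=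
  (unitBump k).hasCompactSupport.comp_smul (by positivity)

variable {k m}

theorem cutoff_nonneg (x : EuclideanSpace ℝ (Fin k)) : 0 ≤ cutoff k m x :=
  (unitBump k).nonneg

theorem cutoff_le_one (x : EuclideanSpace ℝ (Fin k)) : cutoff k m x ≤ 1 :=
  (unitBump k).le_one

theorem cutoff_eq_one {x : EuclideanSpace ℝ (Fin k)} (hx : ‖x‖ ≤ m + 1) : cutoff k m x = 1 := by
  refine (unitBump k).one_of_mem_closedBall ?_
  rw [mem_closedBall_zero_iff, norm_smul, norm_inv, Real.norm_of_nonneg (by positivity)]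
  exact inv_mul_le_one_of_le₀ hx (by positivity)

theorem eventually_cutoff_eq_one (x : EuclideanSpace ℝ (Fin k)) :
    ∀ᶠ m in atTop, cutoff k m x = 1 := by
  obtain ⟨N, hN⟩ := exists_nat_ge ‖x‖
  filter_upwards [eventually_ge_atTop N] with m hm
  have : (N : ℝ) ≤ m := by exact_mod_cast hm
  exact cutoff_eq_one (by linarith)

theorem eventually_le_cutoff {φ : EuclideanSpace ℝ (Fin k) → ℝ} (hc : HasCompactSupport φ)
    (h1 : ∀ x, φ x ≤ 1) : ∀ᶠ m in atTop, ∀ x, φ x ≤ cutoff k m x := by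
  obtain ⟨R, hR⟩ := hc.isBounded.exists_norm_le
  obtain ⟨N, hN⟩ := exists_nat_ge R
  filter_upwards [eventually_ge_atTop N] with m hm x
  by_cases hx : x ∈ tsupport φ
  · have : (N : ℝ) ≤ m := by exact_mod_cast hm
    rw [cutoff_eq_one (by linarith [hR x hx])]
    exact h1 x
  · rw [image_eq_zero_of_notMem_tsupport hx]
    exact cutoff_nonneg x

/-- Each of the two derivatives of the dilated bump yields a factor `(m + 1)⁻¹`. -/
theorem exists_abs_constCoeffOperator_cutoff_le (C : Matrix (Fin k) (Fin k) ℝ) :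
    ∃ M, ∀ m x, |constCoeffOperator C (cutoff k m) x| ≤ M * (((m : ℝ) + 1)⁻¹) ^ 2 := by
  have hs : ContDiff ℝ 2 (unitBump k) := (unitBump k).contDiff
  obtain ⟨M, hM⟩ := (hasCompactSupport_constCoeffOperator C
    (unitBump k).hasCompactSupport).exists_bound_of_continuous (continuous_constCoeffOperator C hs)
  refine ⟨M, fun m x => ?_⟩
  have : cutoff k m = fun x => unitBump k (((m : ℝ) + 1)⁻¹ • x) := rfl
  rw [this, constCoeffOperator_comp_smul C hs, abs_mul, abs_of_nonneg (sq_nonneg _), mul_comm]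
  exact mul_le_mul_of_nonneg_right (hM _) (sq_nonneg _)

theorem tendsto_integral_cutoff_mul {F : EuclideanSpace ℝ (Fin k) → ℝ} (hF : Integrable F) :
    Tendsto (fun m => ∫ x, cutoff k m x * F x) atTop (𝓝 (∫ x, F x)) := by
  refine tendsto_integral_of_dominated_convergence (fun x => |F x|)
    (fun m => (contDiff_cutoff k m).continuous.aestronglyMeasurable.mul hF.aestronglyMeasurable)
    hF.abs (fun m => ae_of_all _ fun x => ?_) (ae_of_all _ fun x => ?_)
  · rw [norm_mul, Real.norm_of_nonneg (cutoff_nonneg x), Real.norm_eq_abs]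
    exact mul_le_of_le_one_left (abs_nonneg _) (cutoff_le_one x)
  · refine tendsto_const_nhds.congr' ?_
    filter_upwards [eventually_cutoff_eq_one x] with m hm
    rw [hm, one_mul]

end Cutoff

/-! ### Evolution of the total mass -/

namespace SolvesForcedHeat

variable {k : ℕ} {C : Matrix (Fin k) (Fin k) ℝ} {f g Q : ℝ → EuclideanSpace ℝ (Fin k) → ℝ}
  {G : EuclideanSpace ℝ (Fin k) → ℝ} {t₁ t₂ : ℝ}

theorem integrable_of_le (h : SolvesForcedHeat C f g Q) (hG : Integrable G) {t : ℝ} (ht : 0 < t)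
    (hle : ∀ x, |f t x| ≤ G x) : Integrable (f t) :=
  hG.mono' (h.contDiff t ht).continuous.aestronglyMeasurable (ae_of_all _ hle)

/-- No mass escapes to infinity: the increment of `∫ f` is the total contribution of the source. -/
theorem tendsto_integral_cutoff_mul_source (h : SolvesForcedHeat C f g Q) (hC : C.IsSymm)
    (hG : Integrable G) (h1 : 0 < t₁) (h12 : t₁ ≤ t₂)
    (hle : ∀ t ∈ Set.Icc t₁ t₂, ∀ x, |f t x| ≤ G x) :
    Tendsto (fun m => ∫ t in t₁..t₂, ∫ x, cutoff k m x * Q t x) atTop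
      (𝓝 ((∫ x, f t₂ x) - ∫ x, f t₁ x)) := by
  have hi : ∀ t ∈ Set.Icc t₁ t₂, Integrable (f t) := fun t ht =>
    h.integrable_of_le hG (h1.trans_le ht.1) (hle t ht)
  have hlim := (tendsto_integral_cutoff_mul (hi t₂ ⟨h12, le_rfl⟩)).sub
    (tendsto_integral_cutoff_mul (hi t₁ ⟨le_rfl, h12⟩))
  obtain ⟨M, hM⟩ := exists_abs_constCoeffOperator_cutoff_le C
  -- Both derivatives sit on the cutoff, so the error is `O((m+1)⁻²)` from the majorant of `f`
  -- alone.
  have herr : Tendsto (fun m => ∫ t in t₁..t₂, ∫ x, constCoeffOperator C (cutoff k m) x * f t x)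
      atTop (𝓝 0) := by
    refine squeeze_zero_norm (a := fun m : ℕ => (M * (((m : ℝ) + 1)⁻¹) ^ 2 * ∫ x, G x) *
      |t₂ - t₁|) (fun m => ?_) ?_
    · refine intervalIntegral.norm_integral_le_of_norm_le_const fun t ht => ?_
      rw [Set.uIoc_of_le h12] at ht
      rw [← integral_const_mul]
      refine norm_integral_le_of_norm_le (hG.const_mul _) (ae_of_all _ fun x => ?_)
      rw [norm_mul]
      exact mul_le_mul (hM m x) (hle t ⟨ht.1.le, ht.2⟩ x) (norm_nonneg _)
        ((abs_nonneg _).trans (hM m x))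
    · have h0 : Tendsto (fun m : ℕ => ((m : ℝ) + 1)⁻¹) atTop (𝓝 0) := by
        simpa using tendsto_one_div_add_atTop_nhds_zero_nat (𝕜 := ℝ)
      simpa using (((h0.pow 2).const_mul M).mul_const (∫ x, G x)).mul_const |t₂ - t₁|
  have := hlim.sub herr
  rw [sub_zero] at this
  refine this.congr fun m => ?_
  rw [← h.integral_mul_sub_integral_mul hC (contDiff_cutoff k m) (hasCompactSupport_cutoff k m)
    h1 h12, sub_sub_cancel]

/-- Since `Q ≥ 0`, the test function may be replaced by a larger cutoff, whose integrals tend to the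
increment of the mass. Integrability of `Q` over the whole space is never required. -/
theorem integral_mul_source_le (h : SolvesForcedHeat C f g Q) (hC : C.IsSymm)
    (hG : Integrable G) (h1 : 0 < t₁) (h12 : t₁ ≤ t₂)
    (hle : ∀ t ∈ Set.Icc t₁ t₂, ∀ x, |f t x| ≤ G x) (hQ : ∀ t, 0 < t → ∀ x, 0 ≤ Q t x)
    {φ : EuclideanSpace ℝ (Fin k) → ℝ} (hφ : Continuous φ) (hc : HasCompactSupport φ)
    (hφ1 : ∀ x, φ x ≤ 1) :
    ∫ t in t₁..t₂, ∫ x, φ x * Q t x ≤ (∫ x, f t₂ x) - ∫ x, f t₁ x := by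
  refine ge_of_tendsto (h.tendsto_integral_cutoff_mul_source hC hG h1 h12 hle) ?_
  filter_upwards [eventually_le_cutoff hc hφ1] with m hm
  have hcm := (contDiff_cutoff k m).continuous
  refine intervalIntegral.integral_mono_on h12
    (intervalIntegrable_integral_mul_of_hasCompactSupport h.continuousOn_source hφ hc h1 h12)
    (intervalIntegrable_integral_mul_of_hasCompactSupport h.continuousOn_source hcm
      (hasCompactSupport_cutoff k m) h1 h12) fun t ht => ?_
  have ht0 : 0 < t := h1.trans_le ht.1
  have hQc := h.continuous_source ht0
  refine integral_mono ((hφ.mul hQc).integrable_of_hasCompactSupport hc.mul_right)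
    ((hcm.mul hQc).integrable_of_hasCompactSupport (hasCompactSupport_cutoff k m).mul_right)
    fun x => ?_
  exact mul_le_mul_of_nonneg_right (hm x) (hQ t ht0 x)

theorem integral_le_integral (h : SolvesForcedHeat C f g Q) (hC : C.IsSymm)
    (hG : Integrable G) (h1 : 0 < t₁) (h12 : t₁ ≤ t₂)
    (hle : ∀ t ∈ Set.Icc t₁ t₂, ∀ x, |f t x| ≤ G x) (hQ : ∀ t, 0 < t → ∀ x, 0 ≤ Q t x) :
    ∫ x, f t₁ x ≤ ∫ x, f t₂ x := by
  have := h.integral_mul_source_le hC hG h1 h12 hle hQ (φ := 0) continuous_const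
    HasCompactSupport.zero (fun x => zero_le_one)
  simpa using this

theorem integral_eq_integral (h : SolvesForcedHeat C f g Q) (hC : C.IsSymm)
    (hG : Integrable G) (h1 : 0 < t₁) (h12 : t₁ ≤ t₂)
    (hle : ∀ t ∈ Set.Icc t₁ t₂, ∀ x, |f t x| ≤ G x) (hQ : ∀ t, 0 < t → ∀ x, Q t x = 0) :
    ∫ x, f t₁ x = ∫ x, f t₂ x := by
  have hlim := h.tendsto_integral_cutoff_mul_source hC hG h1 h12 hle
  have h0 : (fun m => ∫ t in t₁..t₂, ∫ x, cutoff k m x * Q t x) = fun _ => 0 := by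
    funext m
    rw [intervalIntegral.integral_congr (g := fun _ => 0) fun t ht => ?_]
    · simp
    · rw [Set.uIcc_of_le h12] at ht
      simp [hQ t (h1.trans_le ht.1)]
  rw [h0] at hlim
  linarith [tendsto_nhds_unique hlim tendsto_const_nhds]

/-- A continuous nonnegative source that is positive at one point has positive integral against a
cutoff equal to 1 there, which would increase the mass. Endpoints of the time interval are included.
-/
theorem source_eq_zero (h : SolvesForcedHeat C f g Q) (hC : C.IsSymm)
    (hG : Integrable G) (h1 : 0 < t₁) (h12 : t₁ < t₂)
    (hle : ∀ t ∈ Set.Icc t₁ t₂, ∀ x, |f t x| ≤ G x) (hQ : ∀ t, 0 < t → ∀ x, 0 ≤ Q t x)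
    (heq : ∫ x, f t₁ x = ∫ x, f t₂ x) {t : ℝ} (ht : t ∈ Set.Icc t₁ t₂)
    (x : EuclideanSpace ℝ (Fin k)) : Q t x = 0 := by
  obtain ⟨m, hm⟩ := (eventually_cutoff_eq_one x).exists
  have hcm := (contDiff_cutoff k m).continuous
  have hcc := hasCompactSupport_cutoff k m
  have ht0 : 0 < t := h1.trans_le ht.1
  by_contra hne
  have hint := h.integral_mul_source_le hC hG h1 h12.le hle hQ hcm hcc cutoff_le_one
  rw [heq, sub_self] at hint
  refine absurd hint (not_le.2 ?_)
  refine intervalIntegral.integral_pos h12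
    ((continuousOn_integral_mul_of_hasCompactSupport h.continuousOn_source hcm hcc).mono
      fun s hs => h1.trans_le hs.1) (fun s hs => integral_nonneg fun y =>
        mul_nonneg (cutoff_nonneg y) (hQ s (h1.trans hs.1) y)) ⟨t, ht, ?_⟩
  refine (hcm.mul (h.continuous_source ht0)).integral_pos_of_hasCompactSupport_nonneg_nonzero
    hcc.mul_right (fun y => mul_nonneg (cutoff_nonneg y) (hQ t ht0 y)) (x := x) ?_
  simpa [hm] using hne

end SolvesForcedHeat

/-! ### The equation satisfied by `B(𝐮)` -/

theorem EuclideanSpace.inner_single_one {k : ℕ} (v : EuclideanSpace ℝ (Fin k)) (p : Fin k) :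
    (inner ℝ v (EuclideanSpace.single p (1 : ℝ)) : ℝ) = v p := by
  simp [EuclideanSpace.inner_single_right]

theorem clm_apply_eq_sum {n : ℕ} (L : (Fin n → ℝ) →L[ℝ] ℝ) (v : Fin n → ℝ) :
    L v = ∑ j, v j * L (Pi.single j 1) := by
  conv_lhs => rw [pi_eq_sum_univ' v]
  rw [map_sum]
  refine Finset.sum_congr rfl fun j _ => ?_
  rw [map_smul, smul_eq_mul]

theorem fderiv_fderiv_apply_eq_sum {n : ℕ} (B : (Fin n → ℝ) → ℝ) (y v w : Fin n → ℝ) :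
    fderiv ℝ (fderiv ℝ B) y v w = ∑ i, ∑ j, v i * w j * hessian B y i j := by
  have h : fderiv ℝ (fderiv ℝ B) y v =
      ∑ i, v i • fderiv ℝ (fderiv ℝ B) y (Pi.single i 1) := by
    conv_lhs => rw [pi_eq_sum_univ' v]
    rw [map_sum]
    exact Finset.sum_congr rfl fun j _ => map_smul _ _ _
  rw [h]
  simp only [sum_apply, smul_apply, smul_eq_mul]
  refine Finset.sum_congr rfl fun i _ => ?_
  rw [clm_apply_eq_sum _ w, Finset.mul_sum]
  refine Finset.sum_congr rfl fun j _ => ?_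
  simp only [hessian, Matrix.of_apply]
  ring

theorem dotProduct_concavityMatrix_mulVec {k n : ℕ} (a : Fin n → EuclideanSpace ℝ (Fin k))
    (C : Matrix (Fin k) (Fin k) ℝ) (B : (Fin n → ℝ) → ℝ) (y d : Fin n → ℝ) :
    d ⬝ᵥ concavityMatrix a C B y *ᵥ d =
      ∑ i, ∑ j, d i * d j * ((∑ p, ∑ q, C p q * a i p * a j q) * hessian B y i j) := by
  simp only [dotProduct, Matrix.mulVec, concavityMatrix, Matrix.hadamard_apply,
    transpose_mul_mul_colMatrix_apply, Finset.mul_sum]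
  refine Finset.sum_congr rfl fun i _ => Finset.sum_congr rfl fun j _ => ?_
  ring

section HeatVec

variable {k n : ℕ} {a : Fin n → EuclideanSpace ℝ (Fin k)} {C : Matrix (Fin k) (Fin k) ℝ}
  {B : (Fin n → ℝ) → ℝ} {u : Fin n → ℝ → ℝ}

theorem contDiff_heatExtension {σ : ℝ} {u : ℝ → ℝ} (hσ : 0 < σ) (hu : Integrable u) {t : ℝ}
    (ht : 0 < t) : ContDiff ℝ 2 fun y => heatExtension σ u y t := by
  have h1 : deriv (fun y => heatExtension σ u y t) = fun y => heatDeriv σ u y t :=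
    funext fun y => (hasDerivAt_heatExtension hσ hu y ht).deriv
  have h2 : deriv (fun y => heatDeriv σ u y t) = fun y => heatDeriv₂ σ u y t :=
    funext fun y => (hasDerivAt_heatDeriv hσ hu y ht).deriv
  have h3 : Continuous fun y => heatDeriv₂ σ u y t := continuous_iff_continuousAt.2 fun y =>
    ContinuousAt.comp (f := fun y : ℝ => (y, t)) (g := fun p : ℝ × ℝ => heatDeriv₂ σ u p.1 p.2)
      (continuousAt_heatDeriv₂ hσ hu ht) (by fun_prop)
  rw [show (2 : WithTop ℕ∞) = 1 + 1 by norm_num, contDiff_succ_iff_deriv]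
  refine ⟨fun y => (hasDerivAt_heatExtension hσ hu y ht).differentiableAt, by simp, ?_⟩
  rw [h1, contDiff_one_iff_deriv, h2]
  exact ⟨fun y => (hasDerivAt_heatDeriv hσ hu y ht).differentiableAt, h3⟩

theorem heatVecDeriv_eq (hσ : ∀ j, 0 < quadForm C (a j)) (hu : ∀ j, Integrable (u j))
    (x : EuclideanSpace ℝ (Fin k)) {t : ℝ} (ht : 0 < t) :
    heatVecDeriv a C u x t = fun j => heatDeriv (quadForm C (a j)) (u j) (inner ℝ (a j) x) t :=
  funext fun j => (hasDerivAt_heatExtension (hσ j) (hu j) _ ht).deriv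

/-- The second space derivatives of the heat extensions, at the points `⟨a_j, x⟩`. -/
noncomputable def heatVecDeriv₂ (a : Fin n → EuclideanSpace ℝ (Fin k))
    (C : Matrix (Fin k) (Fin k) ℝ) (u : Fin n → ℝ → ℝ) (x : EuclideanSpace ℝ (Fin k)) (t : ℝ) :
    Fin n → ℝ := fun j => heatDeriv₂ (quadForm C (a j)) (u j) (inner ℝ (a j) x) t

theorem heatVec_mem_openOrthant (hσ : ∀ j, 0 < quadForm C (a j)) (hu : ∀ j, Integrable (u j))
    (h0 : ∀ j y, 0 ≤ u j y) (hpos : ∀ j, 0 < ∫ y, u j y) (x : EuclideanSpace ℝ (Fin k)) {t : ℝ}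
    (ht : 0 < t) : heatVec a C u x t ∈ openOrthant n :=
  fun j => heatExtension_pos (hσ j) (hu j) (h0 j) (hpos j) _ ht

theorem hasDerivAt_comp_inner {h : ℝ → ℝ} {h' : ℝ} {v x : EuclideanSpace ℝ (Fin k)}
    (hh : HasDerivAt h h' (inner ℝ v x)) :
    HasFDerivAt (fun x => h (inner ℝ v x)) (h' • innerSL ℝ v) x :=
  hh.comp_hasFDerivAt x (innerSL ℝ v).hasFDerivAt

theorem hasFDerivAt_heatVec (hσ : ∀ j, 0 < quadForm C (a j)) (hu : ∀ j, Integrable (u j))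
    (x : EuclideanSpace ℝ (Fin k)) {t : ℝ} (ht : 0 < t) :
    HasFDerivAt (fun x => heatVec a C u x t)
      (ContinuousLinearMap.pi fun j => heatVecDeriv a C u x t j • innerSL ℝ (a j)) x := by
  rw [heatVecDeriv_eq hσ hu x ht]
  exact hasFDerivAt_pi.2 fun j =>
    hasDerivAt_comp_inner (hasDerivAt_heatExtension (hσ j) (hu j) _ ht)

theorem hasFDerivAt_heatVecDeriv (hσ : ∀ j, 0 < quadForm C (a j)) (hu : ∀ j, Integrable (u j))
    (x : EuclideanSpace ℝ (Fin k)) {t : ℝ} (ht : 0 < t) (j : Fin n) :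
    HasFDerivAt (fun x => heatVecDeriv a C u x t j)
      (heatVecDeriv₂ a C u x t j • innerSL ℝ (a j)) x := by
  have : (fun x => heatVecDeriv a C u x t j) =
      fun x => heatDeriv (quadForm C (a j)) (u j) (inner ℝ (a j) x) t :=
    funext fun x => congrFun (heatVecDeriv_eq hσ hu x ht) j
  rw [this]
  exact hasDerivAt_comp_inner (hasDerivAt_heatDeriv (hσ j) (hu j) _ ht)

theorem continuousAt_comp_inner_time {h : ℝ × ℝ → ℝ} {v : EuclideanSpace ℝ (Fin k)}
    {p : ℝ × EuclideanSpace ℝ (Fin k)} (hh : ContinuousAt h (inner ℝ v p.2, p.1)) :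
    ContinuousAt (fun p : ℝ × EuclideanSpace ℝ (Fin k) => h (inner ℝ v p.2, p.1)) p :=
  ContinuousAt.comp (f := fun p : ℝ × EuclideanSpace ℝ (Fin k) => (inner ℝ v p.2, p.1)) hh
    (by fun_prop)

theorem continuousAt_heatVec (hσ : ∀ j, 0 < quadForm C (a j)) (hu : ∀ j, Integrable (u j))
    {p : ℝ × EuclideanSpace ℝ (Fin k)} (hp : 0 < p.1) :
    ContinuousAt (fun p : ℝ × EuclideanSpace ℝ (Fin k) => heatVec a C u p.2 p.1) p :=
  continuousAt_pi.2 fun j =>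
    continuousAt_comp_inner_time (continuousAt_heatExtension (hσ j) (hu j) hp)

theorem continuousAt_heatVecDeriv (hσ : ∀ j, 0 < quadForm C (a j)) (hu : ∀ j, Integrable (u j))
    {p : ℝ × EuclideanSpace ℝ (Fin k)} (hp : 0 < p.1) (j : Fin n) :
    ContinuousAt (fun p : ℝ × EuclideanSpace ℝ (Fin k) => heatVecDeriv a C u p.2 p.1 j) p := by
  refine (continuousAt_comp_inner_time (v := a j)
    (continuousAt_heatDeriv (hσ j) (hu j) hp)).congr ?_
  filter_upwards [(isOpen_Ioi.preimage continuous_fst).mem_nhds hp] with q hq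
  exact (congrFun (heatVecDeriv_eq hσ hu q.2 hq) j).symm

theorem continuousAt_heatVecDeriv₂ (hσ : ∀ j, 0 < quadForm C (a j)) (hu : ∀ j, Integrable (u j))
    {p : ℝ × EuclideanSpace ℝ (Fin k)} (hp : 0 < p.1) (j : Fin n) :
    ContinuousAt (fun p : ℝ × EuclideanSpace ℝ (Fin k) => heatVecDeriv₂ a C u p.2 p.1 j) p :=
  continuousAt_comp_inner_time (v := a j) (continuousAt_heatDeriv₂ (hσ j) (hu j) hp)

end HeatVec

namespace IsBrascampLiebBellman

variable {k n : ℕ} {a : Fin n → EuclideanSpace ℝ (Fin k)} {C : Matrix (Fin k) (Fin k) ℝ}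
  {B : (Fin n → ℝ) → ℝ} {u : Fin n → ℝ → ℝ}

theorem fderiv_comp_heatVec (hB : IsBrascampLiebBellman a C B) (hu : ∀ j, Integrable (u j))
    (h0 : ∀ j y, 0 ≤ u j y) (hpos : ∀ j, 0 < ∫ y, u j y) (x v : EuclideanSpace ℝ (Fin k)) {t : ℝ}
    (ht : 0 < t) :
    fderiv ℝ (fun x => B (heatVec a C u x t)) x v =
      fderiv ℝ B (heatVec a C u x t) fun j => heatVecDeriv a C u x t j * inner ℝ (a j) v := by
  have hw := heatVec_mem_openOrthant hB.quadForm_pos hu h0 hpos x ht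
  have h := HasFDerivAt.comp x (hB.hasFDerivAt hw) (hasFDerivAt_heatVec hB.quadForm_pos hu x ht)
  exact congrArg (fun L => L v) h.fderiv

theorem fderiv_fderiv_comp_heatVec (hB : IsBrascampLiebBellman a C B)
    (hu : ∀ j, Integrable (u j)) (h0 : ∀ j y, 0 ≤ u j y) (hpos : ∀ j, 0 < ∫ y, u j y)
    (x v v' : EuclideanSpace ℝ (Fin k)) {t : ℝ} (ht : 0 < t) :
    fderiv ℝ (fun y => fderiv ℝ (fun x => B (heatVec a C u x t)) y v) x v' =
      fderiv ℝ (fderiv ℝ B) (heatVec a C u x t)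
        (fun j => heatVecDeriv a C u x t j * inner ℝ (a j) v')
        (fun j => heatVecDeriv a C u x t j * inner ℝ (a j) v) +
      fderiv ℝ B (heatVec a C u x t)
        fun j => heatVecDeriv₂ a C u x t j * inner ℝ (a j) v' * inner ℝ (a j) v := by
  have h1 : (fun y => fderiv ℝ (fun x => B (heatVec a C u x t)) y v) = fun y =>
      fderiv ℝ B (heatVec a C u y t) fun j => heatVecDeriv a C u y t j * inner ℝ (a j) v :=
    funext fun y => hB.fderiv_comp_heatVec hu h0 hpos y v ht
  have hw := heatVec_mem_openOrthant hB.quadForm_pos hu h0 hpos x ht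
  have h2 := HasFDerivAt.comp x (hB.hasFDerivAt_fderiv hw)
    (hasFDerivAt_heatVec hB.quadForm_pos hu x ht)
  have h3 : HasFDerivAt (fun y j => heatVecDeriv a C u y t j * inner ℝ (a j) v)
      (ContinuousLinearMap.pi fun j => (inner ℝ (a j) v : ℝ) •
        (heatVecDeriv₂ a C u x t j • innerSL ℝ (a j))) x :=
    hasFDerivAt_pi.2 fun j => (hasFDerivAt_heatVecDeriv hB.quadForm_pos hu x ht j).mul_const _
  have h4 := (h2.clm_apply h3).fderiv
  rw [h1]
  refine (congrArg (fun L => L v') h4).trans ?_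
  rw [add_comm]
  simp only [add_apply, ContinuousLinearMap.comp_apply, ContinuousLinearMap.flip_apply,
    Function.comp_apply]
  congr 2
  funext j
  simp only [ContinuousLinearMap.coe_pi', smul_apply, smul_eq_mul, innerSL_apply_apply]
  ring

/-- Differentiating `u_j(⟨a_j, x⟩)` along the axes brings out coordinates of `a_j`. In the Hessian
term they combine with `C` into the entries of `A*CA`; in the gradient term only `⟨C a_j, a_j⟩`
occurs, which is the diffusion rate of `u_j`. -/
theorem constCoeffOperator_comp_heatVec (hB : IsBrascampLiebBellman a C B)
    (hu : ∀ j, Integrable (u j)) (h0 : ∀ j y, 0 ≤ u j y) (hpos : ∀ j, 0 < ∫ y, u j y)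
    (x : EuclideanSpace ℝ (Fin k)) {t : ℝ} (ht : 0 < t) :
    constCoeffOperator C (fun x => B (heatVec a C u x t)) x =
      heatVecDeriv a C u x t ⬝ᵥ
        concavityMatrix a C B (heatVec a C u x t) *ᵥ heatVecDeriv a C u x t +
      fderiv ℝ B (heatVec a C u x t)
        fun j => quadForm C (a j) * heatVecDeriv₂ a C u x t j := by
  simp only [constCoeffOperator, hB.fderiv_fderiv_comp_heatVec hu h0 hpos x _ _ ht, mul_add,
    Finset.sum_add_distrib]
  congr 1
  · rw [dotProduct_concavityMatrix_mulVec]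
    simp only [fderiv_fderiv_apply_eq_sum, EuclideanSpace.inner_single_one,
      Finset.mul_sum, Finset.sum_mul]
    calc _ = ∑ p, ∑ i, ∑ q, ∑ j, _ := Finset.sum_congr rfl fun p _ => Finset.sum_comm
      _ = ∑ i, ∑ p, ∑ q, ∑ j, _ := Finset.sum_comm
      _ = ∑ i, ∑ p, ∑ j, ∑ q, _ := Finset.sum_congr rfl fun i _ =>
        Finset.sum_congr rfl fun p _ => Finset.sum_comm
      _ = ∑ i, ∑ j, ∑ p, ∑ q, _ := Finset.sum_congr rfl fun i _ => Finset.sum_comm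
      _ = _ := Finset.sum_congr rfl fun i _ => Finset.sum_congr rfl fun j _ =>
        Finset.sum_congr rfl fun p _ => Finset.sum_congr rfl fun q _ => ?_
    ring
  · rw [clm_apply_eq_sum]
    simp only [EuclideanSpace.inner_single_one, quadForm_eq_sum]
    have h : ∀ p q, fderiv ℝ B (heatVec a C u x t)
        (fun j => heatVecDeriv₂ a C u x t j * a j p * a j q) =
        ∑ j, heatVecDeriv₂ a C u x t j * a j p * a j q *
          fderiv ℝ B (heatVec a C u x t) (Pi.single j 1) := fun p q => clm_apply_eq_sum _ _
    simp only [h, Finset.mul_sum, Finset.sum_mul]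
    calc _ = ∑ p, ∑ j, ∑ q, _ := Finset.sum_congr rfl fun p _ => Finset.sum_comm
      _ = ∑ j, ∑ p, ∑ q, _ := Finset.sum_comm
      _ = _ := Finset.sum_congr rfl fun j _ =>
        Finset.sum_congr rfl fun p _ => Finset.sum_congr rfl fun q _ => ?_
    ring

/-- `B(𝐮(x, t))` solves the heat equation of the operator `∑ C_{pq} ∂_p ∂_q` with a source. -/
theorem solvesForcedHeat (hB : IsBrascampLiebBellman a C B) (hu : ∀ j, Integrable (u j))
    (h0 : ∀ j y, 0 ≤ u j y) (hpos : ∀ j, 0 < ∫ y, u j y) :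
    SolvesForcedHeat C (fun t x => B (heatVec a C u x t))
      (fun t x => fderiv ℝ B (heatVec a C u x t)
        fun j => quadForm C (a j) * heatVecDeriv₂ a C u x t j)
      (fun t x => heatVecDeriv a C u x t ⬝ᵥ
        (-concavityMatrix a C B (heatVec a C u x t)) *ᵥ heatVecDeriv a C u x t) where
  hasDerivAt x t ht := by
    have h : HasDerivAt (fun t => heatVec a C u x t)
        (fun j => quadForm C (a j) * heatVecDeriv₂ a C u x t j) t :=
      hasDerivAt_pi.2 fun j => hasDerivAt_heatExtension_time (hB.quadForm_pos j) (hu j) _ ht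
    exact (hB.hasFDerivAt
      (heatVec_mem_openOrthant hB.quadForm_pos hu h0 hpos x ht)).comp_hasDerivAt t h
  contDiff t ht := by
    have h : ContDiff ℝ 2 fun x => heatVec a C u x t := contDiff_pi.2 fun j =>
      (contDiff_heatExtension (hB.quadForm_pos j) (hu j) ht).comp
        (contDiff_const.inner ℝ contDiff_id)
    exact hB.contDiffOn.comp_contDiff h fun x =>
      heatVec_mem_openOrthant hB.quadForm_pos hu h0 hpos x ht
  continuousOn_deriv p hp := by
    have ht : 0 < p.1 := hp.1
    have hw := heatVec_mem_openOrthant hB.quadForm_pos hu h0 hpos p.2 ht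
    refine ContinuousAt.continuousWithinAt ?_
    have h1 := ContinuousAt.comp (f := fun p : ℝ × EuclideanSpace ℝ (Fin k) =>
      heatVec a C u p.2 p.1) (hB.continuousAt_fderiv hw) (continuousAt_heatVec hB.quadForm_pos hu ht)
    exact h1.clm_apply (continuousAt_pi.2 fun j => continuousAt_const.mul
      (continuousAt_heatVecDeriv₂ hB.quadForm_pos hu ht j))
  continuousOn_source p hp := by
    have ht : 0 < p.1 := hp.1
    have hw := heatVec_mem_openOrthant hB.quadForm_pos hu h0 hpos p.2 ht
    refine ContinuousAt.continuousWithinAt ?_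
    have h1 := ContinuousAt.comp (f := fun p : ℝ × EuclideanSpace ℝ (Fin k) =>
      heatVec a C u p.2 p.1) (hB.continuousAt_fderiv_fderiv hw)
      (continuousAt_heatVec hB.quadForm_pos hu ht)
    have h2 := continuousAt_heatVecDeriv hB.quadForm_pos hu ht
    simp only [Matrix.neg_mulVec, dotProduct_neg,
      dotProduct_concavityMatrix_mulVec]
    refine (tendsto_finsetSum _ fun i _ => tendsto_finsetSum _ fun j _ => ?_).neg
    refine ((h2 i).mul (h2 j)).mul (continuousAt_const.mul ?_)
    exact (h1.clm_apply continuousAt_const).clm_apply continuousAt_const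
  eq_add x t ht := by
    rw [hB.constCoeffOperator_comp_heatVec hu h0 hpos x ht, Matrix.neg_mulVec, dotProduct_neg]
    ring

theorem source_nonneg (hB : IsBrascampLiebBellman a C B) {y : Fin n → ℝ}
    (hy : y ∈ openOrthant n) (d : Fin n → ℝ) :
    0 ≤ d ⬝ᵥ (-concavityMatrix a C B y) *ᵥ d := by
  simpa using (hB.concave y hy).dotProduct_mulVec_nonneg d

/-- The quadratic form of a semidefinite matrix vanishes only on its kernel; this turns the scalar
equality condition into the vector one. -/
theorem source_eq_zero_iff (hB : IsBrascampLiebBellman a C B) {y : Fin n → ℝ}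
    (hy : y ∈ openOrthant n) (d : Fin n → ℝ) :
    d ⬝ᵥ (-concavityMatrix a C B y) *ᵥ d = 0 ↔ concavityMatrix a C B y *ᵥ d = 0 := by
  have h := (hB.concave y hy).dotProduct_mulVec_zero_iff d
  rw [star_trivial] at h
  rw [h, Matrix.neg_mulVec, neg_eq_zero]

end IsBrascampLiebBellman

/-! ### The limits of `∫ B(𝐮)` at time zero and at infinity -/

/-- Transfers measurability and almost everywhere convergence from the line to `ℝᵏ`: a nonzero
functional is surjective, so it pulls null sets back to null sets. -/
theorem quasiMeasurePreserving_inner {k : ℕ} {v : EuclideanSpace ℝ (Fin k)} (hv : v ≠ 0) :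
    Measure.QuasiMeasurePreserving (fun x : EuclideanSpace ℝ (Fin k) => (inner ℝ v x : ℝ)) := by
  have hs : Function.Surjective (innerSL ℝ v : EuclideanSpace ℝ (Fin k) →ₗ[ℝ] ℝ) := fun r => by
    refine ⟨(r / inner ℝ v v) • v, ?_⟩
    have : (inner ℝ v v : ℝ) ≠ 0 := inner_self_ne_zero.2 hv
    simp only [ContinuousLinearMap.coe_coe, innerSL_apply_apply, inner_smul_right]
    field_simp
  obtain ⟨c, -, hc⟩ := LinearMap.exists_map_addHaar_eq_smul_addHaar
    (innerSL ℝ v : EuclideanSpace ℝ (Fin k) →ₗ[ℝ] ℝ) volume volume hs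
  refine ⟨by fun_prop, ?_⟩
  have h : Measure.map (fun x : EuclideanSpace ℝ (Fin k) => (inner ℝ v x : ℝ)) volume =
      c • volume := hc
  rw [h]
  exact Measure.smul_absolutelyContinuous

theorem ne_zero_of_quadForm_pos {k : ℕ} {C : Matrix (Fin k) (Fin k) ℝ}
    {v : EuclideanSpace ℝ (Fin k)} (h : 0 < quadForm C v) : v ≠ 0 := by
  rintro rfl
  simp [quadForm] at h

theorem gaussianOfMass_nonneg {σ : ℝ} {u : ℝ → ℝ} (hu : 0 ≤ ∫ y, u y) (y : ℝ) :
    0 ≤ gaussianOfMass σ u y := by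
  unfold gaussianOfMass
  positivity

namespace IsBrascampLiebBellman

variable {k n : ℕ} {a : Fin n → EuclideanSpace ℝ (Fin k)} {C : Matrix (Fin k) (Fin k) ℝ}
  {B : (Fin n → ℝ) → ℝ} {u : Fin n → ℝ → ℝ}

theorem integrable_bellmanIntegrand (hB : IsBrascampLiebBellman a C B)
    (huE : ∀ j, GaussianDecay (u j)) (h0 : ∀ j y, 0 ≤ u j y) :
    Integrable (bellmanIntegrand a B u) := by
  obtain ⟨b, hb, δ, hδ, hle⟩ := exists_common_gaussian_bound
    (P := fun j b δ => 0 < b ∧ ∀ y, |u j y| ≤ b * Real.exp (-δ * y ^ 2))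
    (fun j => by
      obtain ⟨-, b, hb, δ, hδ, h⟩ := huE j
      exact ⟨b, hb, δ, hδ, hb, h⟩)
    fun j b b' δ δ' hbb hδδ h => ⟨h.1.trans_le hbb, fun y =>
      (h.2 y).trans (mul_exp_le_mul_exp (h.1.trans_le hbb) hbb hδδ y)⟩
  refine hB.integrable_comp hb hδ (fun j => ?_) (fun x j => h0 j _) fun x j =>
    (le_abs_self _).trans ((hle j).2 _)
  exact (huE j).1.comp_quasiMeasurePreserving
    (quasiMeasurePreserving_inner (ne_zero_of_quadForm_pos (hB.quadForm_pos j)))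

theorem gaussianDecay_gaussianOfMass {σ : ℝ} (hσ : 0 < σ) {u : ℝ → ℝ} (hu : 0 < ∫ y, u y) :
    GaussianDecay (gaussianOfMass σ u) := by
  refine ⟨?_, 1 / Real.sqrt (Real.pi * σ) * ∫ y, u y, ?_, 1 / σ, by positivity, fun y => ?_⟩
  · exact (by unfold gaussianOfMass; fun_prop : Continuous (gaussianOfMass σ u)).aemeasurable
  · have : 0 < Real.sqrt (Real.pi * σ) := Real.sqrt_pos.2 (by positivity)
    positivity
  · rw [abs_of_nonneg (gaussianOfMass_nonneg hu.le y), gaussianOfMass,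
      show -(1 / σ) * y ^ 2 = -y ^ 2 / σ by ring]
    exact le_of_eq (by ring)

theorem aemeasurable_heatVec (hB : IsBrascampLiebBellman a C B) (hu : ∀ j, Integrable (u j))
    {t : ℝ} (ht : 0 < t) (c : ℝ) (j : Fin n) :
    AEMeasurable fun x => heatVec a C u (c • x) t j := by
  have h1 : Continuous fun y => heatExtension (quadForm C (a j)) (u j) y t :=
    (contDiff_heatExtension (hB.quadForm_pos j) (hu j) ht).continuous
  have h2 : Continuous fun x : EuclideanSpace ℝ (Fin k) => (inner ℝ (a j) (c • x) : ℝ) := by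
    fun_prop
  exact (h1.comp h2).aemeasurable

theorem exists_heatVec_le (hB : IsBrascampLiebBellman a C B) (huE : ∀ j, GaussianDecay (u j))
    {T : ℝ} (hT : 0 < T) :
    ∃ b > 0, ∃ δ > 0, ∀ t, 0 < t → t ≤ T → ∀ x j,
      heatVec a C u x t j ≤ b * Real.exp (-δ * inner ℝ (a j) x ^ 2) := by
  obtain ⟨b, hb, δ, hδ, hle⟩ := exists_common_gaussian_bound
    (P := fun j b δ => 0 < b ∧ ∀ t, 0 < t → t ≤ T → ∀ y,
      heatExtension (quadForm C (a j)) (u j) y t ≤ b * Real.exp (-δ * y ^ 2))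
    (fun j => by
      have hi := (huE j).integrable
      obtain ⟨-, b, hb, δ, hδ, h⟩ := huE j
      obtain ⟨δ', hδ', h'⟩ := heatExtension_le_of_time_le (hB.quadForm_pos j) hb hδ hi
        (fun y => (le_abs_self _).trans (h y)) hT
      exact ⟨b, hb, δ', hδ', hb, h'⟩)
    fun j b b' δ δ' hbb hδδ h => ⟨h.1.trans_le hbb, fun t ht htT y =>
      (h.2 t ht htT y).trans (mul_exp_le_mul_exp (h.1.trans_le hbb) hbb hδδ y)⟩
  exact ⟨b, hb, δ, hδ, fun t ht htT x j => (hle j).2 t ht htT _⟩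

theorem exists_rescaled_heatVec_le (hB : IsBrascampLiebBellman a C B)
    (huE : ∀ j, GaussianDecay (u j)) :
    ∃ b > 0, ∃ δ > 0, ∀ t, 1 ≤ t → ∀ x j,
      (2 * Real.sqrt t) * heatVec a C u ((2 * Real.sqrt t) • x) t j ≤
        b * Real.exp (-δ * inner ℝ (a j) x ^ 2) := by
  obtain ⟨b, hb, δ, hδ, hle⟩ := exists_common_gaussian_bound
    (P := fun j b δ => 0 < b ∧ ∀ t, 1 ≤ t → ∀ y,
      2 * Real.sqrt t * heatExtension (quadForm C (a j)) (u j) (2 * Real.sqrt t * y) t ≤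
        b * Real.exp (-δ * y ^ 2))
    (fun j => by
      have hi := (huE j).integrable
      obtain ⟨-, b, hb, δ, hδ, h⟩ := huE j
      obtain ⟨b', hb', δ', hδ', h'⟩ := rescaled_heatExtension_le (hB.quadForm_pos j) hb hδ hi
        (fun y => (le_abs_self _).trans (h y))
      exact ⟨b', hb', δ', hδ', hb', h'⟩)
    fun j b b' δ δ' hbb hδδ h => ⟨h.1.trans_le hbb, fun t ht y =>
      (h.2 t ht y).trans (mul_exp_le_mul_exp (h.1.trans_le hbb) hbb hδδ y)⟩
  refine ⟨b, hb, δ, hδ, fun t ht x j => ?_⟩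
  have := (hle j).2 t ht (inner ℝ (a j) x)
  simpa only [heatVec, inner_smul_right] using this

theorem tendsto_integral_heatVec_zero (hB : IsBrascampLiebBellman a C B)
    (huE : ∀ j, GaussianDecay (u j)) (h0 : ∀ j y, 0 ≤ u j y) (hpos : ∀ j, 0 < ∫ y, u j y) :
    Tendsto (fun t => ∫ x, B (heatVec a C u x t)) (𝓝[>] 0)
      (𝓝 (∫ x, bellmanIntegrand a B u x)) := by
  obtain ⟨b, hb, δ, hδ, hle⟩ := hB.exists_heatVec_le huE one_pos
  have hu := fun j => (huE j).integrable
  refine hB.tendsto_integral_comp (v := fun t x => heatVec a C u x t) hb hδ ?_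
    (fun x j => h0 j _) ?_
  · filter_upwards [Ioc_mem_nhdsGT one_pos] with t ht
    refine ⟨fun j => ?_, fun x j => ⟨?_, hle t ht.1 ht.2 x j⟩⟩
    · simpa using hB.aemeasurable_heatVec hu ht.1 1 j
    · exact (heatVec_mem_openOrthant hB.quadForm_pos hu h0 hpos x ht.1 j).le
  · refine ae_all_iff.2 fun j => ?_
    have h1 : ∀ᵐ y, Tendsto (fun t => heatExtension (quadForm C (a j)) (u j) y t) (𝓝[>] 0)
        (𝓝 (u j y)) := by
      obtain ⟨-, b, hb, δ, hδ, h⟩ := huE j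
      refine ae_tendsto_heatExtension (b := b) (hB.quadForm_pos j) (hu j) fun y =>
        (h y).trans (mul_le_of_le_one_right hb.le (Real.exp_le_one_iff.2 ?_))
      nlinarith [sq_nonneg y]
    exact (quasiMeasurePreserving_inner
      (ne_zero_of_quadForm_pos (hB.quadForm_pos j))).ae h1

/-- The factor `(2√t)^k` from homogeneity is exactly the Jacobian of the dilation of `ℝᵏ`. -/
theorem integral_comp_heatVec_eq_rescaled (hB : IsBrascampLiebBellman a C B)
    (hu : ∀ j, Integrable (u j)) (h0 : ∀ j y, 0 ≤ u j y) (hpos : ∀ j, 0 < ∫ y, u j y) {t : ℝ}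
    (ht : 0 < t) :
    ∫ x, B ((2 * Real.sqrt t) • heatVec a C u ((2 * Real.sqrt t) • x) t) =
      ∫ x, B (heatVec a C u x t) := by
  have hr : 0 < 2 * Real.sqrt t := by positivity
  have h1 : ∀ x, B ((2 * Real.sqrt t) • heatVec a C u ((2 * Real.sqrt t) • x) t) =
      (2 * Real.sqrt t) ^ k * B (heatVec a C u ((2 * Real.sqrt t) • x) t) := fun x =>
    hB.homogeneous _ hr.le _ (openOrthant_subset_closedOrthant n
      (heatVec_mem_openOrthant hB.quadForm_pos hu h0 hpos _ ht))
  simp only [h1]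
  rw [integral_const_mul, Measure.integral_comp_smul volume (fun x => B (heatVec a C u x t)),
    finrank_euclideanSpace_fin, abs_of_pos (by positivity), smul_eq_mul, ← mul_assoc,
    mul_inv_cancel₀ (by positivity), one_mul]

theorem tendsto_integral_heatVec_atTop (hB : IsBrascampLiebBellman a C B)
    (huE : ∀ j, GaussianDecay (u j)) (h0 : ∀ j y, 0 ≤ u j y) (hpos : ∀ j, 0 < ∫ y, u j y) :
    Tendsto (fun t => ∫ x, B (heatVec a C u x t)) atTop
      (𝓝 (∫ x, bellmanIntegrand a B (fun j => gaussianOfMass (quadForm C (a j)) (u j)) x)) := by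
  obtain ⟨b, hb, δ, hδ, hle⟩ := hB.exists_rescaled_heatVec_le huE
  have hu := fun j => (huE j).integrable
  have hlim := hB.tendsto_integral_comp (l := atTop)
    (v := fun t x => (2 * Real.sqrt t) • heatVec a C u ((2 * Real.sqrt t) • x) t)
    (w := fun x j => gaussianOfMass (quadForm C (a j)) (u j) (inner ℝ (a j) x)) hb hδ ?_
    (fun x j => gaussianOfMass_nonneg (hpos j).le _) (ae_of_all _ fun x j => ?_)
  · refine hlim.congr' ?_
    filter_upwards [eventually_gt_atTop 0] with t ht
    exact hB.integral_comp_heatVec_eq_rescaled hu h0 hpos ht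
  · filter_upwards [eventually_ge_atTop 1] with t ht
    have ht0 : 0 < t := one_pos.trans_le ht
    refine ⟨fun j => (hB.aemeasurable_heatVec hu ht0 _ j).const_mul _, fun x j => ⟨?_, hle t ht x j⟩⟩
    exact mul_nonneg (by positivity)
      (heatVec_mem_openOrthant hB.quadForm_pos hu h0 hpos _ ht0 j).le
  · have := tendsto_rescaled_heatExtension (hB.quadForm_pos j) (hu j) (inner ℝ (a j) x)
    simpa only [heatVec, inner_smul_right, Pi.smul_apply, smul_eq_mul] using this

theorem exists_integrable_bound_heatVec (hB : IsBrascampLiebBellman a C B)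
    (huE : ∀ j, GaussianDecay (u j)) (h0 : ∀ j y, 0 ≤ u j y) (hpos : ∀ j, 0 < ∫ y, u j y)
    {T : ℝ} (hT : 0 < T) :
    ∃ G : EuclideanSpace ℝ (Fin k) → ℝ, Integrable G ∧
      ∀ t, 0 < t → t ≤ T → ∀ x, |B (heatVec a C u x t)| ≤ G x := by
  obtain ⟨b, hb, δ, hδ, hle⟩ := hB.exists_heatVec_le huE hT
  refine ⟨_, hB.integrable_gaussian hb hδ, fun t ht htT x => hB.norm_comp_le (fun j => ?_)
    fun j => hle t ht htT x j⟩
  exact (heatVec_mem_openOrthant hB.quadForm_pos (fun j => (huE j).integrable) h0 hpos x ht j).le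

end IsBrascampLiebBellman

/-! ### The inequality and its equality case -/

theorem theorem1p6 (k n : ℕ) (hk : 1 ≤ k) (hkn : k ≤ n)
    (a : Fin n → EuclideanSpace ℝ (Fin k)) (C : Matrix (Fin k) (Fin k) ℝ)
    (B : (Fin n → ℝ) → ℝ) (hB : IsBrascampLiebBellman a C B)
    (u : Fin n → ℝ → ℝ) (huE : ∀ j, GaussianDecay (u j))
    (hu_nonneg : ∀ j y, 0 ≤ u j y) (hu_pos : ∀ j, 0 < ∫ y, u j y) :
    Integrable (bellmanIntegrand a B u) ∧
    Integrable (bellmanIntegrand a B fun j => gaussianOfMass (quadForm C (a j)) (u j)) ∧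
    (∫ x, bellmanIntegrand a B u x ≤
      ∫ x, bellmanIntegrand a B (fun j => gaussianOfMass (quadForm C (a j)) (u j)) x) ∧
    (∫ x, bellmanIntegrand a B u x =
        ∫ x, bellmanIntegrand a B (fun j => gaussianOfMass (quadForm C (a j)) (u j)) x ↔
      ∀ (x : EuclideanSpace ℝ (Fin k)) (t : ℝ), 0 < t →
        concavityMatrix a C B (heatVec a C u x t) *ᵥ heatVecDeriv a C u x t = 0) := by
  have hu := fun j => (huE j).integrable
  have hsol := hB.solvesForcedHeat hu hu_nonneg hu_pos
  have hw : ∀ x t, 0 < t → heatVec a C u x t ∈ openOrthant n := fun x t ht =>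
    heatVec_mem_openOrthant hB.quadForm_pos hu hu_nonneg hu_pos x ht
  have hQ : ∀ t, 0 < t → ∀ x, 0 ≤ heatVecDeriv a C u x t ⬝ᵥ
      (-concavityMatrix a C B (heatVec a C u x t)) *ᵥ heatVecDeriv a C u x t :=
    fun t ht x => hB.source_nonneg (hw x t ht) _
  have hbound := fun {T : ℝ} (hT : 0 < T) =>
    hB.exists_integrable_bound_heatVec huE hu_nonneg hu_pos hT
  set F : ℝ → ℝ := fun t => ∫ x, B (heatVec a C u x t) with hF
  have hmono : ∀ t₁ t₂, 0 < t₁ → t₁ ≤ t₂ → F t₁ ≤ F t₂ := fun t₁ t₂ h1 h12 => by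
    obtain ⟨G, hG, hle⟩ := hbound (h1.trans_le h12)
    exact hsol.integral_le_integral hB.symm hG h1 h12
      (fun t ht => hle t (h1.trans_le ht.1) ht.2) hQ
  have hzero := hB.tendsto_integral_heatVec_zero huE hu_nonneg hu_pos
  have htop := hB.tendsto_integral_heatVec_atTop huE hu_nonneg hu_pos
  have hlow : ∀ t, 0 < t → ∫ x, bellmanIntegrand a B u x ≤ F t := fun t ht => by
    refine le_of_tendsto hzero ?_
    filter_upwards [Ioc_mem_nhdsGT ht] with s hs
    exact hmono s t hs.1 hs.2
  have hhigh : ∀ t, 0 < t →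
      F t ≤ ∫ x, bellmanIntegrand a B (fun j => gaussianOfMass (quadForm C (a j)) (u j)) x :=
    fun t ht => by
      refine ge_of_tendsto htop ?_
      filter_upwards [eventually_ge_atTop t] with s hs
      exact hmono t s ht hs
  refine ⟨hB.integrable_bellmanIntegrand huE hu_nonneg,
    hB.integrable_bellmanIntegrand
      (fun j => IsBrascampLiebBellman.gaussianDecay_gaussianOfMass (hB.quadForm_pos j) (hu_pos j))
      fun j => gaussianOfMass_nonneg (hu_pos j).le,
    (hlow 1 one_pos).trans (hhigh 1 one_pos), fun heq x t ht => ?_, fun hM => ?_⟩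
  -- Equality of the two limits squeezes the monotone `F`, so `F t = F (t + 1)` and the source
  -- vanishes on `[t, t + 1]`.
  · obtain ⟨G, hG, hle⟩ := hbound (T := t + 1) (by linarith)
    refine (hB.source_eq_zero_iff (hw x t ht) _).1 (hsol.source_eq_zero hB.symm hG ht
      (lt_add_one t) (fun s hs => hle s (ht.trans_le hs.1) hs.2) hQ ?_
      ⟨le_rfl, (lt_add_one t).le⟩ x)
    exact le_antisymm (hmono t (t + 1) ht (by linarith))
      ((hhigh (t + 1) (by linarith)).trans (heq ▸ hlow t ht))
  -- Conversely, with no source the mass is conserved, so `F` equals both of its limits.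
  · have hconst : ∀ t₁ t₂, 0 < t₁ → t₁ ≤ t₂ → F t₁ = F t₂ := fun t₁ t₂ h1 h12 => by
      obtain ⟨G, hG, hle⟩ := hbound (h1.trans_le h12)
      exact hsol.integral_eq_integral hB.symm hG h1 h12
        (fun t ht => hle t (h1.trans_le ht.1) ht.2)
        fun t ht x => (hB.source_eq_zero_iff (hw x t ht) _).2 (hM x t ht)
    have h1 : ∫ x, bellmanIntegrand a B u x = F 1 := by
      refine tendsto_nhds_unique hzero (tendsto_const_nhds.congr' ?_)
      filter_upwards [Ioc_mem_nhdsGT one_pos] with s hs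
      exact (hconst s 1 hs.1 hs.2).symm
    have h2 : F 1 =
        ∫ x, bellmanIntegrand a B (fun j => gaussianOfMass (quadForm C (a j)) (u j)) x := by
      refine tendsto_nhds_unique (tendsto_const_nhds.congr' ?_) htop
      filter_upwards [eventually_ge_atTop 1] with s hs
      exact hconst 1 s one_pos hs
    exact h1.trans h2
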